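/- Let $a<b$ be real numbers. A partition of $[a,b]$ is a finite sequence $a=t_0<t_1<\dots<t_n=b$. Let $\Lambda[a,b]$ be the set of all sequences $\lambda=\{\lambda_m\colon m\ge 1\}$ of partitions $\lambda_m=\{t_i^m\colon i=0,\dots,n(m)\}$ of $[a,b]$ with $\lambda_m\subset\lambda_{m+1}$ for all $m$ and $\bigcup_m\lambda_m$ dense in $[a,b]$. A function $f\colon[a,b]\to\mathbb{R}$ is regulated if the finite limits $f(t-)$, $t\in(a,b]$, and $f(s+)$, $s\in[a,b)$, exist; put $\Delta^-f(t)=f(t)-f(t-)$ for $t\in(a,b]$ and $\Delta^+f(s)=f(s+)-f(s)$ for $s\in[a,b)$. For $0<p<\infty$, $f$ has bounded $p$-variation, $f\in\mathcal{W}_p$, if $\sup\sum_{i=1}^n|f(t_i)-f(t_{i-1})|^p<\infty$, the supremum being over all partitions of $[a,b]$. Let $\mathrm{dual}(\mathcal{W}_1)$ be the class of all regulated functions on $[a,b]$ and, for $1<p<\infty$, let $\mathrm{dual}(\mathcal{W}_p)=\bigcup\{\mathcal{W}_q\colon q>0,\ \tfrac1p+\tfrac1q>1\}$. For $\lambda\in\Lambda[a,b]$,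 a regulated function $f$ has the quadratic $\lambda$-variation on $[a,b]$ if there is a regulated function $V$ on $[a,b]$ with $V(a)=0$ such that for all $a\le s<t\le b$, with $x_i^m=(t_i^m\wedge t)\vee s$, $$V(t)-V(s)=\lim_{m\to\infty}\sum_{i=1}^{n(m)}\big[f(x_i^m)-f(x_{i-1}^m)\big]^2,\qquad \Delta^-V(t)=(\Delta^-f(t))^2,\qquad \Delta^+V(s)=(\Delta^+f(s))^2.$$ For $\lambda\in\Lambda[a,b]$ and $1\le p<2$, a regulated function $f$ on $[a,b]$ is $(\lambda,p)$-decomposable if there is a pair $(g,h)$ of regulated functions on $[a,b]$ such that $g$ has the quadratic $\lambda$-variation, $g\in\mathrm{dual}(\mathcal{W}_p)$, $h\in\mathcal{W}_p$, $g(a)=h(a)=0$ and $f=C+g+h$ on $[a,b]$ for some constant $C$. Let $D_{\lambda,p}(f)$ be the set of all such pairs. Let $D^+_{\lambda,p}(f)$ be the set of all $(g,h)\in D_{\lambda,p}(f)$ such that every $t\in(a,b)$ with $\Delta^+g(t)\ne0$ or $\Delta^+h(t)\ne0$ belongs to $\bigcup_m\lambda_m$, and let $D^-_{\lambda,p}(f)$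 be defined in the same way with $\Delta^-$ in place of $\Delta^+$. **Theorem.** Let $\lambda\in\Lambda[a,b]$ and $1\le p<2$, let $f$ be a $(\lambda,p)$-decomposable function on $[a,b]$, and let $\phi\colon\mathbb{R}\to\mathbb{R}$ be a $C^2$ function. If $D^+_{\lambda,p}(f)\cup D^-_{\lambda,p}(f)\neq\emptyset$, then the composition $\phi\circ f$ is $(\lambda,p)$-decomposable. -/

import Mathlib

/-- A partition `a = t₀ < t₁ < ⋯ < tₙ = b` of `[a, b]`; only the values `pt 0, …, pt n` matter. -/
structure IntervalPartition (a b : ℝ) where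
  /-- the number of subintervals -/
  n : ℕ
  /-- the points of the partition -/
  pt : ℕ → ℝ
  pt_zero : pt 0 = a
  pt_last : pt n = b
  strictMonoOn : StrictMonoOn pt (Set.Iic n)

/-- The finite set of points `{t₀, …, tₙ}` of a partition. -/
def IntervalPartition.points {a b : ℝ} (κ : IntervalPartition a b) : Set ℝ :=
  κ.pt '' Set.Iic κ.n

/-- The class `Λ[a, b]` of nested sequences of partitions of `[a, b]` whose union is dense
in `[a, b]`. -/
structure NestedPartitions (a b : ℝ) where
  /-- the sequence of partitions -/
  part : ℕ → IntervalPartition a b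
  nested : ∀ m, (part m).points ⊆ (part (m + 1)).points
  dense : Set.Icc a b ⊆ closure (⋃ m, (part m).points)

/-- The union `⋃ₘ λₘ` of all partition points. -/
def NestedPartitions.points {a b : ℝ} (lam : NestedPartitions a b) : Set ℝ :=
  ⋃ m, (lam.part m).points

/-- `f` is regulated on `[a, b]`: it has finite left limits on `(a, b]` and finite right limits
on `[a, b)`. -/
def IsRegulated (a b : ℝ) (f : ℝ → ℝ) : Prop :=
  (∀ t ∈ Set.Ioc a b, ∃ l : ℝ, Filter.Tendsto f (nhdsWithin t (Set.Iio t)) (nhds l)) ∧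
  (∀ s ∈ Set.Ico a b, ∃ r : ℝ, Filter.Tendsto f (nhdsWithin s (Set.Ioi s)) (nhds r))

/-- The left jump `Δ⁻f(t) = f(t) - f(t-)`. -/
noncomputable def leftJump (f : ℝ → ℝ) (t : ℝ) : ℝ := f t - Function.leftLim f t

/-- The right jump `Δ⁺f(s) = f(s+) - f(s)`. -/
noncomputable def rightJump (f : ℝ → ℝ) (s : ℝ) : ℝ := Function.rightLim f s - f s

/-- The `p`-variation sum of `f` along a partition. -/
noncomputable def IntervalPartition.varSum {a b : ℝ} (κ : IntervalPartition a b) (p : ℝ)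
    (f : ℝ → ℝ) : ℝ :=
  ∑ i ∈ Finset.range κ.n, |f (κ.pt (i + 1)) - f (κ.pt i)| ^ p

/-- `f ∈ W_p[a, b]`: `f` has bounded `p`-variation on `[a, b]` (used for `0 < p < ∞`). -/
def HasBoundedPVariation (a b p : ℝ) (f : ℝ → ℝ) : Prop :=
  BddAbove (Set.range fun κ : IntervalPartition a b => κ.varSum p f)

/-- `f ∈ dual(W_p)[a, b]` for `1 ≤ p < ∞`. -/
def MemDual (a b p : ℝ) (f : ℝ → ℝ) : Prop :=
  (p = 1 ∧ IsRegulated a b f) ∨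
  (1 < p ∧ ∃ q : ℝ, 0 < q ∧ 1 < 1 / p + 1 / q ∧ HasBoundedPVariation a b q f)

/-- The sum of squared increments of `f` over the trace `xᵢ = (tᵢ ∧ t) ∨ s` on `[s, t]` of a
partition of `[a, b]`. -/
noncomputable def IntervalPartition.sqSum {a b : ℝ} (κ : IntervalPartition a b) (f : ℝ → ℝ)
    (s t : ℝ) : ℝ :=
  ∑ i ∈ Finset.range κ.n,
    (f (max (min (κ.pt (i + 1)) t) s) - f (max (min (κ.pt i) t) s)) ^ 2

/-- `V` is the bracket function of `f` on `[a, b]` along the sequence of partitions `lam`. -/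
def IsBracket {a b : ℝ} (lam : NestedPartitions a b) (f V : ℝ → ℝ) : Prop :=
  IsRegulated a b V ∧ V a = 0 ∧
  (∀ s t : ℝ, a ≤ s → s < t → t ≤ b →
    Filter.Tendsto (fun m => (lam.part m).sqSum f s t) Filter.atTop (nhds (V t - V s))) ∧
  (∀ t ∈ Set.Ioc a b, leftJump V t = (leftJump f t) ^ 2) ∧
  (∀ s ∈ Set.Ico a b, rightJump V s = (rightJump f s) ^ 2)

/-- `f ∈ Q_λ[a, b]`: the regulated function `f` has the quadratic `λ`-variation on `[a, b]`. -/
def HasQuadraticVariation {a b : ℝ} (lam : NestedPartitions a b) (f : ℝ → ℝ) : Prop :=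
  IsRegulated a b f ∧ ∃ V : ℝ → ℝ, IsBracket lam f V

/-- `D_{λ,p}(f)`: the set of `(λ, p)`-dual pairs `(g, h)` which `(λ, p)`-decompose `f`. -/
def dualPairs {a b : ℝ} (lam : NestedPartitions a b) (p : ℝ) (f : ℝ → ℝ) :
    Set ((ℝ → ℝ) × (ℝ → ℝ)) :=
  {gh | IsRegulated a b gh.1 ∧ IsRegulated a b gh.2 ∧
    HasQuadraticVariation lam gh.1 ∧ MemDual a b p gh.1 ∧
    HasBoundedPVariation a b p gh.2 ∧
    gh.1 a = 0 ∧ gh.2 a = 0 ∧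
    ∃ C : ℝ, ∀ t ∈ Set.Icc a b, f t = C + gh.1 t + gh.2 t}

/-- `f ∈ 𝓓_{λ,p}[a, b]`: the regulated function `f` is `(λ, p)`-decomposable on `[a, b]`. -/
def IsDecomposable {a b : ℝ} (lam : NestedPartitions a b) (p : ℝ) (f : ℝ → ℝ) : Prop :=
  IsRegulated a b f ∧ (dualPairs lam p f).Nonempty

/-- The right discontinuity points of `f` in `(a, b)` are accessible by `lam`. -/
def RightAccessible {a b : ℝ} (lam : NestedPartitions a b) (f : ℝ → ℝ) : Prop :=
  {t ∈ Set.Ioo a b | rightJump f t ≠ 0} ⊆ lam.points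

/-- The left discontinuity points of `f` in `(a, b)` are accessible by `lam`. -/
def LeftAccessible {a b : ℝ} (lam : NestedPartitions a b) (f : ℝ → ℝ) : Prop :=
  {t ∈ Set.Ioo a b | leftJump f t ≠ 0} ⊆ lam.points

/-- `D⁺_{λ,p}(f)`. -/
def dualPairsPlus {a b : ℝ} (lam : NestedPartitions a b) (p : ℝ) (f : ℝ → ℝ) :
    Set ((ℝ → ℝ) × (ℝ → ℝ)) :=
  {gh ∈ dualPairs lam p f | RightAccessible lam gh.1 ∧ RightAccessible lam gh.2}

/-- `D⁻_{λ,p}(f)`. -/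
def dualPairsMinus {a b : ℝ} (lam : NestedPartitions a b) (p : ℝ) (f : ℝ → ℝ) :
    Set ((ℝ → ℝ) × (ℝ → ℝ)) :=
  {gh ∈ dualPairs lam p f | LeftAccessible lam gh.1 ∧ LeftAccessible lam gh.2}

/-! The composition is decomposed trivially: the pair is `(φ ∘ f - φ (f a), 0)`. It remains to see
that `φ ∘ f` lies in the dual class and has a quadratic `λ`-variation.

Dual class: for `p = 1` only regularity is needed. For `p > 1`, `φ` is Lipschitz on the bounded
range of `f`, so `φ ∘ f` has bounded `r`-variation with `r = max p q`, and `1/p + 1/r > 1` because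
`p < 2` (`memDual_comp_sub_const`).

Quadratic variation: by the mean value theorem a squared increment of `φ ∘ f` is `φ'(ξ)²` times that
of `f = C + g + h`. The latter differs from the squared increment of `g` by terms containing an
increment of `h`. By duality these have small sums over intervals on which `g` and `h` move little
(`exists_sum_mixedIncr_le`). Just to one side of a point `φ'(f)²` is almost a constant `k`, so
inside such an interval the sum for `φ ∘ f` is nearly `k` times the convergent sum for `g`; the two
end intervals contribute jumps in the limit (`approxSqSum_of_oscillation`).

Finitely many one-sided intervals cover `[s, t]` (`forall_Icc_of_local`). Gluing at `x` creates a
cross term tending to `2 Δ⁻F(x) Δ⁺F(x)` for `F = φ ∘ f` if `x` is not a partition point, and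
eventually zero otherwise. Accessibility on one side makes it vanish in all cases. Errors are sums
of one fixed interval function over inner intervals, hence superadditive, so the number of pieces
does not matter. Limits therefore exist; the jump conditions follow because inner sums near a point
are small (`IsRegulated.exists_isBracket`). -/

open Filter Topology

/-! ### Sums of squares over the trace of one partition. -/

namespace IntervalPartition

variable {a b : ℝ} (κ : IntervalPartition a b)

theorem pt_le_pt {i j : ℕ} (hij : i ≤ j) (hj : j ≤ κ.n) : κ.pt i ≤ κ.pt j :=
  κ.strictMonoOn.monotoneOn (Set.mem_Iic.2 (hij.trans hj)) (Set.mem_Iic.2 hj) hij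

theorem pt_lt_pt {i j : ℕ} (hij : i < j) (hj : j ≤ κ.n) : κ.pt i < κ.pt j :=
  κ.strictMonoOn (Set.mem_Iic.2 (hij.le.trans hj)) (Set.mem_Iic.2 hj) hij

theorem pt_mem_Icc {i : ℕ} (hi : i ≤ κ.n) : κ.pt i ∈ Set.Icc a b := by
  constructor
  · have := κ.pt_le_pt (Nat.zero_le i) hi
    rwa [κ.pt_zero] at this
  · have := κ.pt_le_pt hi le_rfl
    rwa [κ.pt_last] at this

theorem lt_of_pt_lt {i j : ℕ} (hi : i ≤ κ.n) (h : κ.pt i < κ.pt j) : i < j := by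
  by_contra hij
  exact absurd (κ.pt_le_pt (not_lt.1 hij) hi) (not_le.2 h)

/-- A point of `[a, b)` lies in one of the intervals `[tᵢ, tᵢ₊₁)`. -/
theorem exists_le_lt {u : ℝ} (hu : u ∈ Set.Ico a b) :
    ∃ i < κ.n, κ.pt i ≤ u ∧ u < κ.pt (i + 1) := by
  have hex : ∃ k, u < κ.pt k := ⟨κ.n, by rw [κ.pt_last]; exact hu.2⟩
  classical
  have h0 : Nat.find hex ≠ 0 := by
    intro h
    have := Nat.find_spec hex
    rw [h, κ.pt_zero] at this
    exact absurd hu.1 (not_le.2 this)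
  obtain ⟨i, hi⟩ := Nat.exists_eq_succ_of_ne_zero h0
  have hle : Nat.find hex ≤ κ.n := Nat.find_min' hex (by rw [κ.pt_last]; exact hu.2)
  refine ⟨i, by omega, ?_, ?_⟩
  · exact not_lt.1 (Nat.find_min hex (by omega))
  · have := Nat.find_spec hex
    rwa [hi] at this

/-- A point of `(a, b]` lies in one of the intervals `(tᵢ, tᵢ₊₁]`. -/
theorem exists_lt_le {u : ℝ} (hu : u ∈ Set.Ioc a b) :
    ∃ i < κ.n, κ.pt i < u ∧ u ≤ κ.pt (i + 1) := by
  have hex : ∃ k, u ≤ κ.pt k := ⟨κ.n, by rw [κ.pt_last]; exact hu.2⟩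
  classical
  have h0 : Nat.find hex ≠ 0 := by
    intro h
    have := Nat.find_spec hex
    rw [h, κ.pt_zero] at this
    exact absurd hu.1 (not_lt.2 this)
  obtain ⟨i, hi⟩ := Nat.exists_eq_succ_of_ne_zero h0
  have hle : Nat.find hex ≤ κ.n := Nat.find_min' hex (by rw [κ.pt_last]; exact hu.2)
  refine ⟨i, by omega, ?_, ?_⟩
  · exact not_le.1 (Nat.find_min hex (by omega))
  · have := Nat.find_spec hex
    rwa [hi] at this

/-- The indices of the intervals of a partition whose closure lies in the open interval
`(u, v)`. -/
noncomputable def inner (u v : ℝ) : Finset ℕ :=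
  (Finset.range κ.n).filter fun i => u < κ.pt i ∧ κ.pt (i + 1) < v

theorem mem_inner {u v : ℝ} {i : ℕ} :
    i ∈ κ.inner u v ↔ i < κ.n ∧ u < κ.pt i ∧ κ.pt (i + 1) < v := by
  simp [inner]

/-- The sum of an interval function over the intervals of a partition whose closure lies in the
open interval `(u, v)`. -/
noncomputable def innerSum (w : ℝ → ℝ → ℝ) (u v : ℝ) : ℝ :=
  ∑ i ∈ κ.inner u v, w (κ.pt i) (κ.pt (i + 1))

theorem innerSum_nonneg {w : ℝ → ℝ → ℝ} (hw : ∀ x y, 0 ≤ w x y) (u v : ℝ) :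
    0 ≤ κ.innerSum w u v :=
  Finset.sum_nonneg fun _ _ => hw _ _

/-- Intervals touching or straddling `x` are counted on the right only. This superadditivity keeps
errors from accumulating when intervals are glued. -/
theorem innerSum_add_innerSum_le {w : ℝ → ℝ → ℝ} (hw : ∀ x y, 0 ≤ w x y) {u x v : ℝ}
    (hux : u ≤ x) (hxv : x ≤ v) :
    κ.innerSum w u x + κ.innerSum w x v ≤ κ.innerSum w u v := by
  unfold innerSum
  rw [← Finset.sum_union]
  · refine Finset.sum_le_sum_of_subset_of_nonneg ?_ fun _ _ _ => hw _ _
    intro i hi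
    rw [Finset.mem_union, mem_inner, mem_inner] at hi
    rw [mem_inner]
    rcases hi with ⟨h1, h2, h3⟩ | ⟨h1, h2, h3⟩
    · exact ⟨h1, h2, h3.trans_le hxv⟩
    · exact ⟨h1, hux.trans_lt h2, h3⟩
  · rw [Finset.disjoint_left]
    intro i hi hi'
    rw [mem_inner] at hi hi'
    have := κ.pt_lt_pt (Nat.lt_succ_self i) hi.1
    have h1 := hi.2.2
    have h2 := hi'.2.1
    simp only [Nat.succ_eq_add_one] at this
    linarith

/-- The trace truncates only the interval around `u` and the one around `v`, which differ since `i <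
j`. Intervals outside `[u, v]` collapse to a point, and all others are inner. -/
theorem sqSum_eq_innerSum_add {u v : ℝ} {i j : ℕ} (hij : i < j) (hj : j < κ.n)
    (hi1 : κ.pt i ≤ u) (hi2 : u < κ.pt (i + 1)) (hj1 : κ.pt j < v) (hj2 : v ≤ κ.pt (j + 1))
    (G : ℝ → ℝ) :
    κ.sqSum G u v = κ.innerSum (fun x y => (G y - G x) ^ 2) u v +
      (G (κ.pt (i + 1)) - G u) ^ 2 + (G v - G (κ.pt j)) ^ 2 := by
  have huv : u < v := hi2.trans_le ((κ.pt_le_pt hij hj.le).trans hj1.le)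
  unfold sqSum innerSum inner
  rw [Finset.sum_filter]
  have e1 : (G (κ.pt (i + 1)) - G u) ^ 2 =
      ∑ k ∈ Finset.range κ.n, if k = i then (G (κ.pt (i + 1)) - G u) ^ 2 else 0 := by
    rw [Finset.sum_ite_eq' (Finset.range κ.n) i, if_pos (Finset.mem_range.2 (hij.trans hj))]
  have e2 : (G v - G (κ.pt j)) ^ 2 =
      ∑ k ∈ Finset.range κ.n, if k = j then (G v - G (κ.pt j)) ^ 2 else 0 := by
    rw [Finset.sum_ite_eq' (Finset.range κ.n) j, if_pos (Finset.mem_range.2 hj)]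
  rw [e1, e2, ← Finset.sum_add_distrib, ← Finset.sum_add_distrib]
  refine Finset.sum_congr rfl fun k hk => ?_
  have hk := Finset.mem_range.1 hk
  rcases lt_trichotomy k i with h | h | h
  · have h1 : κ.pt (k + 1) ≤ u := (κ.pt_le_pt h (hij.trans hj).le).trans hi1
    have h2 : κ.pt k ≤ u := (κ.pt_le_pt h.le (hij.trans hj).le).trans hi1
    rw [if_neg h.ne, if_neg (show k ≠ j by omega),
      if_neg (fun h' : u < κ.pt k ∧ κ.pt (k + 1) < v => absurd h'.1 (not_lt.2 h2)),
      max_eq_right ((min_le_left _ _).trans h1), max_eq_right ((min_le_left _ _).trans h2)]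
    ring
  · subst h
    have h1 : κ.pt (k + 1) ≤ v := (κ.pt_le_pt hij hj.le).trans hj1.le
    rw [if_pos rfl, if_neg (show k ≠ j by omega),
      if_neg (fun h' : u < κ.pt k ∧ κ.pt (k + 1) < v => absurd h'.1 (not_lt.2 hi1)),
      max_eq_right ((min_le_left _ _).trans hi1), min_eq_left h1, max_eq_left hi2.le]
    ring
  · have h0 : u < κ.pt k := hi2.trans_le (κ.pt_le_pt h hk.le)
    rcases lt_trichotomy k j with h' | h' | h'
    · have h1 : κ.pt (k + 1) < v := (κ.pt_le_pt h' hj.le).trans_lt hj1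
      have h2 : κ.pt k < v := (κ.pt_le_pt h'.le hj.le).trans_lt hj1
      have h3 : κ.pt k < κ.pt (k + 1) := κ.pt_lt_pt (Nat.lt_succ_self k) hk
      rw [if_neg h.ne', if_neg h'.ne, if_pos ⟨h0, h1⟩, min_eq_left h1.le, min_eq_left h2.le,
        max_eq_left h0.le, max_eq_left (h0.trans h3).le]
      ring
    · subst h'
      rw [if_neg h.ne', if_pos rfl,
        if_neg (fun h' : u < κ.pt k ∧ κ.pt (k + 1) < v => absurd h'.2 (not_lt.2 hj2)),
        min_eq_right hj2, min_eq_left hj1.le, max_eq_left huv.le, max_eq_left h0.le]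
      ring
    · have h1 : v ≤ κ.pt k := hj2.trans (κ.pt_le_pt h' hk.le)
      have h3 : κ.pt k < κ.pt (k + 1) := κ.pt_lt_pt (Nat.lt_succ_self k) hk
      rw [if_neg h.ne', if_neg h'.ne', min_eq_right h1, min_eq_right (h1.trans h3.le),
        if_neg (fun h' : u < κ.pt k ∧ κ.pt (k + 1) < v => absurd h'.2 (not_lt.2 (h1.trans h3.le)))]
      ring

/-- Only the interval containing `x` is cut differently, and there `(c + d)² - c² - d² = 2cd`. -/
theorem sqSum_sub_sub {u x v : ℝ} (hux : u ≤ x) (hxv : x ≤ v) {i : ℕ} (hi : i < κ.n)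
    (hi1 : κ.pt i ≤ x) (hi2 : x < κ.pt (i + 1)) (G : ℝ → ℝ) :
    κ.sqSum G u v - κ.sqSum G u x - κ.sqSum G x v =
      2 * (G (min (κ.pt (i + 1)) v) - G x) * (G x - G (max (κ.pt i) u)) := by
  unfold sqSum
  rw [← Finset.sum_sub_distrib, ← Finset.sum_sub_distrib, Finset.sum_eq_single i]
  · rw [max_eq_left (le_min (hux.trans hi2.le) (hux.trans hxv)), min_eq_left (hi1.trans hxv),
      min_eq_right hi2.le, max_eq_left hux, min_eq_left hi1,
      max_eq_left (le_min hi2.le hxv), max_eq_right hi1]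
    ring
  · intro k hk hki
    have hk := Finset.mem_range.1 hk
    rcases lt_or_gt_of_ne hki with h | h
    · have h1 : κ.pt (k + 1) ≤ x := (κ.pt_le_pt h hi.le).trans hi1
      have h2 : κ.pt k ≤ x := (κ.pt_le_pt h.le hi.le).trans hi1
      rw [min_eq_left h1, min_eq_left h2, min_eq_left (h1.trans hxv), min_eq_left (h2.trans hxv),
        max_eq_right h1, max_eq_right h2]
      ring
    · have h1 : x ≤ κ.pt k := hi2.le.trans (κ.pt_le_pt h hk.le)
      have h2 : x ≤ κ.pt (k + 1) := hi2.le.trans (κ.pt_le_pt (Nat.succ_le_succ h.le) hk)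
      rw [min_eq_right h1, min_eq_right h2, max_eq_left hux, max_eq_left (le_min h1 hxv),
        max_eq_left (le_min h2 hxv), max_eq_left (hux.trans (le_min h1 hxv)),
        max_eq_left (hux.trans (le_min h2 hxv))]
      ring
  · intro h
    exact absurd (Finset.mem_range.2 hi) h

theorem sqSum_self (G : ℝ → ℝ) :
    κ.sqSum G a b = ∑ i ∈ Finset.range κ.n, (G (κ.pt (i + 1)) - G (κ.pt i)) ^ 2 := by
  refine Finset.sum_congr rfl fun i hi => ?_
  have hi := Finset.mem_range.1 hi
  have h1 := κ.pt_mem_Icc hi.le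
  have h2 := κ.pt_mem_Icc (Nat.succ_le_of_lt hi)
  rw [min_eq_left h1.2, min_eq_left h2.2, max_eq_left h1.1, max_eq_left h2.1]

end IntervalPartition

/-! ### Neighbouring partition points of a given point. -/

namespace NestedPartitions

variable {a b : ℝ} (lam : NestedPartitions a b)

theorem points_mono : Monotone fun m => (lam.part m).points :=
  monotone_nat_of_le_succ lam.nested

theorem eventually_mem_points {x : ℝ} (hx : x ∈ lam.points) :
    ∀ᶠ m in atTop, x ∈ (lam.part m).points := by
  obtain ⟨k, hk⟩ := Set.mem_iUnion.1 hx
  filter_upwards [eventually_ge_atTop k] with m hm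
  exact lam.points_mono hm hk

theorem eventually_exists_pt_mem_Ioo {u v : ℝ} (hu : a ≤ u) (huv : u < v) (hv : v ≤ b) :
    ∀ᶠ m in atTop, ∃ k ≤ (lam.part m).n, (lam.part m).pt k ∈ Set.Ioo u v := by
  have hmid : (u + v) / 2 ∈ Set.Ioo u v := ⟨by linarith, by linarith⟩
  have hcl := lam.dense (⟨by linarith, by linarith⟩ : (u + v) / 2 ∈ Set.Icc a b)
  obtain ⟨y, hy, hy'⟩ := mem_closure_iff.1 hcl _ isOpen_Ioo hmid
  filter_upwards [lam.eventually_mem_points hy'] with m hm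
  obtain ⟨k, hk, rfl⟩ := hm
  exact ⟨k, hk, hy⟩

/-- The first partition point to the right of `u` tends to `u`. -/
theorem exists_right_index {u : ℝ} (hu : u ∈ Set.Ico a b) :
    ∃ i : ℕ → ℕ, (∀ m, i m < (lam.part m).n ∧ (lam.part m).pt (i m) ≤ u ∧
      u < (lam.part m).pt (i m + 1)) ∧
      Tendsto (fun m => (lam.part m).pt (i m + 1)) atTop (𝓝[>] u) := by
  choose i hi using fun m => (lam.part m).exists_le_lt hu
  refine ⟨i, hi, ?_⟩
  rw [(nhdsGT_basis u).tendsto_right_iff]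
  intro c hc
  filter_upwards [lam.eventually_exists_pt_mem_Ioo hu.1 (lt_min hc hu.2) (min_le_right c b)]
    with m ⟨k, hk, hk'⟩
  refine ⟨(hi m).2.2, ?_⟩
  have hik : i m < k := (lam.part m).lt_of_pt_lt (hi m).1.le ((hi m).2.1.trans_lt hk'.1)
  exact ((lam.part m).pt_le_pt hik hk).trans_lt (hk'.2.trans_le (min_le_left _ _))

/-- The last partition point to the left of `v` tends to `v`. -/
theorem exists_left_index {v : ℝ} (hv : v ∈ Set.Ioc a b) :
    ∃ j : ℕ → ℕ, (∀ m, j m < (lam.part m).n ∧ (lam.part m).pt (j m) < v ∧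
      v ≤ (lam.part m).pt (j m + 1)) ∧
      Tendsto (fun m => (lam.part m).pt (j m)) atTop (𝓝[<] v) := by
  choose j hj using fun m => (lam.part m).exists_lt_le hv
  refine ⟨j, hj, ?_⟩
  rw [(nhdsLT_basis v).tendsto_right_iff]
  intro c hc
  filter_upwards [lam.eventually_exists_pt_mem_Ioo (le_max_right c a) (max_lt hc hv.1) hv.2]
    with m ⟨k, hk, hk'⟩
  refine ⟨?_, (hj m).2.1⟩
  have hjk : k < j m + 1 := (lam.part m).lt_of_pt_lt hk (hk'.2.trans_le (hj m).2.2)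
  exact (le_max_left c a).trans_lt (hk'.1.trans_le
    ((lam.part m).pt_le_pt (Nat.lt_succ_iff.1 hjk) (hj m).1.le))

end NestedPartitions

/-! ### Asymptotics of sums of squares of a regulated function. -/

namespace IsRegulated

variable {a b : ℝ} {F : ℝ → ℝ}

theorem tendsto_left (hF : IsRegulated a b F) {t : ℝ} (ht : t ∈ Set.Ioc a b) :
    Tendsto F (𝓝[<] t) (𝓝 (Function.leftLim F t)) :=
  tendsto_leftLim_of_tendsto (hF.1 t ht)

theorem tendsto_right (hF : IsRegulated a b F) {s : ℝ} (hs : s ∈ Set.Ico a b) :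
    Tendsto F (𝓝[>] s) (𝓝 (Function.rightLim F s)) :=
  tendsto_rightLim_of_tendsto (hF.2 s hs)

/-- Sums of squares over a trace, up to the jumps at the ends, are sums over inner intervals. -/
theorem tendsto_sqSum_sub_innerSum (hF : IsRegulated a b F) (lam : NestedPartitions a b)
    {u v : ℝ} (hu : a ≤ u) (huv : u < v) (hv : v ≤ b) :
    Tendsto (fun m => (lam.part m).sqSum F u v -
      (lam.part m).innerSum (fun x y => (F y - F x) ^ 2) u v) atTop
      (𝓝 (rightJump F u ^ 2 + leftJump F v ^ 2)) := by
  have hu' : u ∈ Set.Ico a b := ⟨hu, huv.trans_le hv⟩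
  have hv' : v ∈ Set.Ioc a b := ⟨hu.trans_lt huv, hv⟩
  obtain ⟨i, hi, hi'⟩ := lam.exists_right_index hu'
  obtain ⟨j, hj, hj'⟩ := lam.exists_left_index hv'
  have h1 := (((hF.tendsto_right hu').comp hi').sub_const (F u)).pow 2
  have h2 := (((hF.tendsto_left hv').comp hj').const_sub (F v)).pow 2
  refine (h1.add h2).congr' ?_
  filter_upwards [lam.eventually_exists_pt_mem_Ioo hu huv hv] with m ⟨k, hk, hk'⟩
  have hik : i m < k := (lam.part m).lt_of_pt_lt (hi m).1.le ((hi m).2.1.trans_lt hk'.1)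
  have hkj : k < j m + 1 := (lam.part m).lt_of_pt_lt hk (hk'.2.trans_le (hj m).2.2)
  have := (lam.part m).sqSum_eq_innerSum_add (hik.trans_le (Nat.lt_succ_iff.1 hkj)) (hj m).1
    (hi m).2.1 (hi m).2.2 (hj m).2.1 (hj m).2.2 F
  rw [this]
  simp only [Function.comp_apply]
  ring

/-- Asymptotic additivity of sums of squares. -/
theorem tendsto_sqSum_sub_sub (hF : IsRegulated a b F) (lam : NestedPartitions a b)
    {u x v : ℝ} (hu : a ≤ u) (hux : u < x) (hxv : x < v) (hv : v ≤ b)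
    (hx : x ∉ lam.points → leftJump F x * rightJump F x = 0) :
    Tendsto (fun m => (lam.part m).sqSum F u v - (lam.part m).sqSum F u x -
      (lam.part m).sqSum F x v) atTop (𝓝 0) := by
  have hx1 : x ∈ Set.Ico a b := ⟨hu.trans hux.le, hxv.trans_le hv⟩
  have hx2 : x ∈ Set.Ioc a b := ⟨hu.trans_lt hux, hxv.le.trans hv⟩
  obtain ⟨i, hi, hi'⟩ := lam.exists_right_index hx1
  have key : ∀ m, (lam.part m).sqSum F u v - (lam.part m).sqSum F u x -
      (lam.part m).sqSum F x v = 2 * (F (min ((lam.part m).pt (i m + 1)) v) - F x) *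
        (F x - F (max ((lam.part m).pt (i m)) u)) := fun m =>
    (lam.part m).sqSum_sub_sub hux.le hxv.le (hi m).1 (hi m).2.1 (hi m).2.2 F
  simp only [key]
  by_cases hxl : x ∈ lam.points
  -- Once `x` is a partition point it is the left end of its interval, so the cross term is exactly
  -- zero.
  · refine tendsto_const_nhds.congr' ?_
    filter_upwards [lam.eventually_mem_points hxl] with m ⟨k, hk, hkx⟩
    have hki : k ≤ i m := Nat.lt_succ_iff.1
      ((lam.part m).lt_of_pt_lt hk (by rw [hkx]; exact (hi m).2.2))
    have : (lam.part m).pt (i m) = x :=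
      le_antisymm (hi m).2.1 (hkx ▸ (lam.part m).pt_le_pt hki (hi m).1.le)
    rw [this, max_eq_left hux.le]
    ring
  -- If `x` is never a partition point, both neighbours approach it strictly from their sides and
  -- the cross term tends to twice the product of the jumps.
  · have hne : ∀ m, (lam.part m).pt (i m) < x := fun m =>
      lt_of_le_of_ne (hi m).2.1 fun h =>
        hxl (Set.mem_iUnion.2 ⟨m, i m, Set.mem_Iic.2 (hi m).1.le, h⟩)
    have hr : Tendsto (fun m => min ((lam.part m).pt (i m + 1)) v) atTop (𝓝[>] x) := by
      refine hi'.congr' ?_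
      filter_upwards [hi' (Ioo_mem_nhdsGT hxv)] with m hm
      exact (min_eq_left hm.2.le).symm
    have hl : Tendsto (fun m => max ((lam.part m).pt (i m)) u) atTop (𝓝[<] x) := by
      rw [(nhdsLT_basis x).tendsto_right_iff]
      intro c hc
      filter_upwards [lam.eventually_exists_pt_mem_Ioo (hu.trans (le_max_right c u))
        (max_lt hc hux) (hxv.le.trans hv)] with m ⟨k, hk, hk'⟩
      have hki : k < i m + 1 :=
        (lam.part m).lt_of_pt_lt hk (hk'.2.trans (hi m).2.2)
      refine ⟨lt_max_of_lt_left ?_, max_lt (hne m) hux⟩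
      exact (le_max_left c u).trans_lt (hk'.1.trans_le
        ((lam.part m).pt_le_pt (Nat.lt_succ_iff.1 hki) (hi m).1.le))
    have h1 := (((hF.tendsto_right hx1).comp hr).sub_const (F x)).const_mul 2
    have h2 := ((hF.tendsto_left hx2).comp hl).const_sub (F x)
    have h3 := h1.mul h2
    have e : 2 * (Function.rightLim F x - F x) * (F x - Function.leftLim F x) = 0 := by
      have := hx hxl
      unfold leftJump rightJump at this
      linarith
    rwa [e] at h3

end IsRegulated

/-! ### From local to global on `[a, b]`. -/

/-- A property of intervals which holds for all short intervals to one side of each point, and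
which is inherited by the union of two adjacent intervals, holds for all intervals. -/
theorem forall_Icc_of_local {a b : ℝ} {P : ℝ → ℝ → Prop}
    (glue : ∀ u x v, a ≤ u → u < x → x < v → v ≤ b → P u x → P x v → P u v)
    (right : ∀ x ∈ Set.Ico a b, ∀ᶠ y in 𝓝[>] x, ∀ u v, x ≤ u → u < v → v ≤ y → P u v)
    (left : ∀ x ∈ Set.Ioc a b, ∀ᶠ y in 𝓝[<] x, ∀ u v, y ≤ u → u < v → v ≤ x → P u v)
    {u v : ℝ} (hu : a ≤ u) (huv : u < v) (hv : v ≤ b) : P u v := by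
  -- Gluing at `x` turns the two one-sided hypotheses into a two-sided one, to which compactness
  -- applies.
  have hloc : ∀ x : Set.Icc u v, ∃ δ > 0, ∀ s t, a ≤ s → s < t → t ≤ b →
      (x : ℝ) - δ < s → t < x + δ → P s t := by
    rintro ⟨x, hx⟩
    have h1 : ∃ δ > 0, ∀ s t, t ≤ b → x ≤ s → s < t → t < x + δ → P s t := by
      by_cases hxb : x < b
      · obtain ⟨y, hy, hxy⟩ :=
          ((right x ⟨hu.trans hx.1, hxb⟩).and self_mem_nhdsWithin).exists
        refine ⟨y - x, sub_pos.2 hxy, fun s t _ h1 h2 h3 => hy s t h1 h2 (by linarith)⟩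
      · exact ⟨1, one_pos, fun s t h0 h1 h2 _ => absurd (h1.trans_lt (h2.trans_le h0)) hxb⟩
    have h2 : ∃ δ > 0, ∀ s t, a ≤ s → s < t → t ≤ x → x - δ < s → P s t := by
      by_cases hax : a < x
      · obtain ⟨y, hy, hxy⟩ :=
          ((left x ⟨hax, hx.2.trans hv⟩).and self_mem_nhdsWithin).exists
        refine ⟨x - y, sub_pos.2 hxy, fun s t _ h1 h2 h3 => hy s t (by linarith) h1 h2⟩
      · exact ⟨1, one_pos, fun s t h0 h1 h2 _ => absurd (h0.trans_lt (h1.trans_le h2)) hax⟩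
    obtain ⟨δ₁, hδ₁, h1⟩ := h1
    obtain ⟨δ₂, hδ₂, h2⟩ := h2
    refine ⟨min δ₁ δ₂, lt_min hδ₁ hδ₂, fun s t has hst htb hs ht => ?_⟩
    have hs : x - min δ₁ δ₂ < s := hs
    have ht : t < x + min δ₁ δ₂ := ht
    have m1 := min_le_left δ₁ δ₂
    have m2 := min_le_right δ₁ δ₂
    rcases le_or_gt t x with htx | htx
    · exact h2 s t has hst htx (by linarith)
    rcases le_or_gt x s with hsx | hsx
    · exact h1 s t htb hsx hst (by linarith)
    · exact glue s x t has hsx htx htb (h2 s x has hsx le_rfl (by linarith))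
        (h1 x t htb le_rfl htx (by linarith))
  choose δ hδ hP using hloc
  -- The chain `τ` is only weakly increasing, whereas `P` is available on nondegenerate intervals
  -- only; hence the strictness conditions in `step` and `key`.
  obtain ⟨τ, hτ0, hmono, ⟨N, hN⟩, hτ⟩ := exists_monotone_Icc_subset_open_cover_Icc huv.le
    (c := fun x : Set.Icc u v => Metric.ball x (δ x)) (fun _ => Metric.isOpen_ball)
    (fun x _ => Set.mem_iUnion.2 ⟨x, Metric.mem_ball_self (hδ x)⟩)
  have hmem : ∀ n, a ≤ (τ n : ℝ) ∧ (τ n : ℝ) ≤ b := fun n =>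
    ⟨hu.trans (τ n).2.1, (τ n).2.2.trans hv⟩
  have step : ∀ n, (τ n : ℝ) < τ (n + 1) → P (τ n) (τ (n + 1)) := by
    intro n hn
    obtain ⟨x, hx⟩ := hτ n
    have h1 := hx ⟨le_rfl, hmono (Nat.le_succ n)⟩
    have h2 := hx ⟨hmono (Nat.le_succ n), le_rfl⟩
    rw [Metric.mem_ball, Subtype.dist_eq, Real.dist_eq, abs_lt] at h1 h2
    exact hP x _ _ (hmem n).1 hn (hmem _).2 (by linarith) (by linarith)
  have key : ∀ n, u < τ n → P u (τ n) := by
    intro n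
    induction n with
    | zero =>
      intro h
      rw [hτ0] at h
      exact absurd h (lt_irrefl u)
    | succ n ih =>
      intro h
      have hle : (τ n : ℝ) ≤ τ (n + 1) := hmono (Nat.le_succ n)
      rcases hle.eq_or_lt with he | hlt
      · rw [← he] at h ⊢
        exact ih h
      · rcases (τ n).2.1.eq_or_lt with he | hlt'
        · have := step n hlt
          rwa [← he] at this
        · exact glue _ _ _ hu hlt' hlt (hmem _).2 (ih hlt') (step n hlt)
  have := key N
  rw [hN N le_rfl] at this
  exact this huv

/-! ### Boundedness and composition of regulated functions. -/

namespace IsRegulated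

variable {a b : ℝ} {f : ℝ → ℝ}

theorem exists_bound (hab : a < b) (hf : IsRegulated a b f) :
    ∃ M, ∀ x ∈ Set.Icc a b, |f x| ≤ M := by
  refine forall_Icc_of_local (a := a) (b := b)
    (P := fun u v => ∃ M, ∀ x ∈ Set.Icc u v, |f x| ≤ M) ?_ ?_ ?_ le_rfl hab le_rfl
  · rintro u x v - - - - ⟨M, hM⟩ ⟨M', hM'⟩
    refine ⟨max M M', fun y hy => ?_⟩
    rcases le_total y x with h | h
    · exact (hM y ⟨hy.1, h⟩).trans (le_max_left _ _)
    · exact (hM' y ⟨h, hy.2⟩).trans (le_max_right _ _)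
  · intro x hx
    have h1 := (hf.tendsto_right hx).abs.eventually_lt_const
      (lt_add_one |Function.rightLim f x|)
    obtain ⟨z, hz, hz'⟩ := mem_nhdsGT_iff_exists_Ioo_subset.1 h1
    filter_upwards [Ioo_mem_nhdsGT hz] with y hy u v hu huv hv
    refine ⟨max |f x| (|Function.rightLim f x| + 1), fun t ht => ?_⟩
    rcases (hu.trans ht.1).eq_or_lt with h | h
    · rw [← h]; exact le_max_left _ _
    · exact (le_of_lt (hz' ⟨h, (ht.2.trans hv).trans_lt hy.2⟩)).trans (le_max_right _ _)
  · intro x hx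
    have h1 := (hf.tendsto_left hx).abs.eventually_lt_const
      (lt_add_one |Function.leftLim f x|)
    obtain ⟨z, hz, hz'⟩ := mem_nhdsLT_iff_exists_Ioo_subset.1 h1
    filter_upwards [Ioo_mem_nhdsLT hz] with y hy u v hu huv hv
    refine ⟨max |f x| (|Function.leftLim f x| + 1), fun t ht => ?_⟩
    rcases (ht.2.trans hv).eq_or_lt with h | h
    · rw [h]; exact le_max_left _ _
    · exact (le_of_lt (hz' ⟨hy.1.trans_le (hu.trans ht.1), h⟩)).trans (le_max_right _ _)

theorem comp {φ : ℝ → ℝ} (hφ : Continuous φ) (hf : IsRegulated a b f) :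
    IsRegulated a b (φ ∘ f) :=
  ⟨fun t ht => (hf.1 t ht).imp' φ fun _ h => (hφ.tendsto _).comp h,
    fun s hs => (hf.2 s hs).imp' φ fun _ h => (hφ.tendsto _).comp h⟩

theorem sub_const (hf : IsRegulated a b f) (c : ℝ) : IsRegulated a b fun x => f x - c :=
  hf.comp (continuous_sub_right c)

end IsRegulated

theorem leftJump_eq_of_tendsto {f : ℝ → ℝ} {t l : ℝ} (h : Tendsto f (𝓝[<] t) (𝓝 l)) :
    leftJump f t = f t - l := by
  rw [leftJump, leftLim_eq_of_tendsto h]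

theorem rightJump_eq_of_tendsto {f : ℝ → ℝ} {t r : ℝ} (h : Tendsto f (𝓝[>] t) (𝓝 r)) :
    rightJump f t = r - f t := by
  rw [rightJump, rightLim_eq_of_tendsto h]

/-! ### Bounded `p`-variation. -/

namespace HasBoundedPVariation

variable {a b p q : ℝ} {f g h : ℝ → ℝ}

theorem const (hp : 0 < p) (c : ℝ) : HasBoundedPVariation a b p fun _ => c := by
  refine ⟨0, ?_⟩
  rintro _ ⟨κ, rfl⟩
  simp [IntervalPartition.varSum, Real.zero_rpow hp.ne']

/-- The variation sums over a set of intervals of a partition are uniformly bounded. -/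
theorem exists_sum_le (hf : HasBoundedPVariation a b p f) :
    ∃ K, 0 ≤ K ∧ ∀ (κ : IntervalPartition a b) (S : Finset ℕ), S ⊆ Finset.range κ.n →
      ∑ i ∈ S, |f (κ.pt (i + 1)) - f (κ.pt i)| ^ p ≤ K := by
  obtain ⟨K, hK⟩ := hf
  refine ⟨max K 0, le_max_right _ _, fun κ S hS => ?_⟩
  exact (Finset.sum_le_sum_of_subset_of_nonneg hS fun _ _ _ => by positivity).trans
    ((hK ⟨κ, rfl⟩).trans (le_max_left _ _))

/-- A function bounded by `M` has increments at most `2M`, so the surplus power `p - q` costs a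
factor `(2M)^(p-q)`. -/
theorem mono_exponent (hab : a < b) (hq : 0 < q) (hqp : q ≤ p) (hf : IsRegulated a b f)
    (h : HasBoundedPVariation a b q f) : HasBoundedPVariation a b p f := by
  obtain ⟨M, hM⟩ := hf.exists_bound hab
  obtain ⟨K, hK0, hK⟩ := h.exists_sum_le
  have hM0 : 0 ≤ M := (abs_nonneg _).trans (hM a ⟨le_rfl, hab.le⟩)
  refine ⟨K * (2 * M) ^ (p - q), ?_⟩
  rintro _ ⟨κ, rfl⟩
  refine le_trans ?_ (mul_le_mul_of_nonneg_right (hK κ _ subset_rfl)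
    (Real.rpow_nonneg (by linarith) _))
  rw [Finset.sum_mul]
  refine Finset.sum_le_sum fun i hi => ?_
  have hi := Finset.mem_range.1 hi
  have h1 := hM _ (κ.pt_mem_Icc hi.le)
  have h2 := hM _ (κ.pt_mem_Icc (Nat.succ_le_of_lt hi))
  have h3 := abs_sub (f (κ.pt (i + 1))) (f (κ.pt i))
  calc |f (κ.pt (i + 1)) - f (κ.pt i)| ^ p
      = |f (κ.pt (i + 1)) - f (κ.pt i)| ^ (q + (p - q)) := by ring_nf
    _ = |f (κ.pt (i + 1)) - f (κ.pt i)| ^ q * |f (κ.pt (i + 1)) - f (κ.pt i)| ^ (p - q) :=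
        Real.rpow_add_of_nonneg (abs_nonneg _) hq.le (sub_nonneg.2 hqp)
    _ ≤ _ := by
        gcongr
        · linarith

/-- The bounds `x + y ≤ 2 max x y` and `(max x y)^q ≤ x^q + y^q` replace Minkowski's inequality and
hold for every `q > 0`. -/
theorem of_abs_sub_le {L : ℝ} (hq : 0 < q) (hL : 0 ≤ L) (hg : HasBoundedPVariation a b q g)
    (hh : HasBoundedPVariation a b q h)
    (hf : ∀ x ∈ Set.Icc a b, ∀ y ∈ Set.Icc a b,
      |f y - f x| ≤ L * (|g y - g x| + |h y - h x|)) : HasBoundedPVariation a b q f := by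
  obtain ⟨K, hK0, hK⟩ := hg.exists_sum_le
  obtain ⟨K', hK0', hK'⟩ := hh.exists_sum_le
  refine ⟨(2 * L) ^ q * (K + K'), ?_⟩
  rintro _ ⟨κ, rfl⟩
  refine le_trans ?_ (mul_le_mul_of_nonneg_left
    (add_le_add (hK κ _ subset_rfl) (hK' κ _ subset_rfl)) (Real.rpow_nonneg (by linarith) _))
  rw [← Finset.sum_add_distrib, Finset.mul_sum]
  refine Finset.sum_le_sum fun i hi => ?_
  have hi := Finset.mem_range.1 hi
  have h1 := hf _ (κ.pt_mem_Icc hi.le) _ (κ.pt_mem_Icc (Nat.succ_le_of_lt hi))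
  simp only [Nat.succ_eq_add_one] at h1
  set x := |g (κ.pt (i + 1)) - g (κ.pt i)|
  set y := |h (κ.pt (i + 1)) - h (κ.pt i)|
  have hx : 0 ≤ x := abs_nonneg _
  have hy : 0 ≤ y := abs_nonneg _
  have hxq : 0 ≤ x ^ q := Real.rpow_nonneg hx _
  have hyq : 0 ≤ y ^ q := Real.rpow_nonneg hy _
  have hmax : (max x y) ^ q ≤ x ^ q + y ^ q := by
    rcases le_total x y with hxy | hxy
    · rw [max_eq_right hxy]; linarith
    · rw [max_eq_left hxy]; linarith
  calc |f (κ.pt (i + 1)) - f (κ.pt i)| ^ q ≤ (2 * L * max x y) ^ q := by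
        refine Real.rpow_le_rpow (abs_nonneg _) (h1.trans ?_) hq.le
        rw [mul_comm 2 L, mul_assoc]
        refine mul_le_mul_of_nonneg_left ?_ hL
        linarith [le_max_left x y, le_max_right x y]
    _ = (2 * L) ^ q * (max x y) ^ q :=
        Real.mul_rpow (by linarith) (hx.trans (le_max_left _ _))
    _ ≤ _ := mul_le_mul_of_nonneg_left hmax (Real.rpow_nonneg (by linarith) _)

end HasBoundedPVariation

/-! ### Smallness of the terms involving `h`. -/

/-- The part of the squared increment of `g + h` that involves `h`, in absolute value. -/
def mixedIncr (g h : ℝ → ℝ) (x y : ℝ) : ℝ :=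
  2 * (|g y - g x| * |h y - h x|) + (h y - h x) ^ 2

theorem mixedIncr_nonneg (g h : ℝ → ℝ) (x y : ℝ) : 0 ≤ mixedIncr g h x y := by
  unfold mixedIncr; positivity

/-- With `M = x^q + y^p` one has `x ≤ M^(1/q)` and `y ≤ M^(1/p)`. One power of `M` is kept to be
summed; the excess `1/p + 1/q - 1` supplies a factor that is small with `δ` when the duality
inequality is strict. -/
theorem mul_le_rpow_mul_add {p q x y δ : ℝ} (hp : 0 < p) (hq : 0 < q) (hpq : 1 ≤ 1 / p + 1 / q)
    (hx : 0 ≤ x) (hy : 0 ≤ y) (hxδ : x ≤ δ) (hyδ : y ≤ δ) :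
    x * y ≤ (δ ^ q + δ ^ p) ^ (1 / p + 1 / q - 1) * (x ^ q + y ^ p) := by
  have hxq : 0 ≤ x ^ q := Real.rpow_nonneg hx _
  have hyp : 0 ≤ y ^ p := Real.rpow_nonneg hy _
  set M := x ^ q + y ^ p with hM
  have hM0 : 0 ≤ M := by positivity
  have h1 : x ≤ M ^ (1 / q) := by
    calc x = (x ^ q) ^ (1 / q) := by
          rw [← Real.rpow_mul hx, mul_one_div_cancel hq.ne', Real.rpow_one]
      _ ≤ _ := Real.rpow_le_rpow hxq (by linarith) (by positivity)
  have h2 : y ≤ M ^ (1 / p) := by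
    calc y = (y ^ p) ^ (1 / p) := by
          rw [← Real.rpow_mul hy, mul_one_div_cancel hp.ne', Real.rpow_one]
      _ ≤ _ := Real.rpow_le_rpow hyp (by linarith) (by positivity)
  calc x * y ≤ M ^ (1 / q) * M ^ (1 / p) := by gcongr
    _ = M ^ ((1 / p + 1 / q - 1) + 1) := by
        rw [← Real.rpow_add_of_nonneg hM0 (by positivity) (by positivity)]
        ring_nf
    _ = M ^ (1 / p + 1 / q - 1) * M := by
        rw [Real.rpow_add_of_nonneg hM0 (by linarith) zero_le_one, Real.rpow_one]
    _ ≤ _ := by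
        refine mul_le_mul_of_nonneg_right ?_ hM0
        refine Real.rpow_le_rpow hM0 ?_ (by linarith)
        exact add_le_add (Real.rpow_le_rpow hx hxδ hq.le) (Real.rpow_le_rpow hy hyδ hp.le)

theorem sq_le_rpow_mul {p y δ : ℝ} (hp : 0 < p) (hp2 : p ≤ 2) (hy : 0 ≤ y) (hyδ : y ≤ δ) :
    y ^ 2 ≤ δ ^ (2 - p) * y ^ p := by
  calc y ^ 2 = y ^ ((2 - p) + p) := by rw [← Real.rpow_natCast]; norm_num
    _ = y ^ (2 - p) * y ^ p := Real.rpow_add_of_nonneg hy (by linarith) hp.le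
    _ ≤ _ := by
        gcongr

/-- The sums of `mixedIncr g h` over intervals with small increments are small when `(g, h)` is a
dual pair. -/
theorem exists_sum_mixedIncr_le {a b p : ℝ} {g h : ℝ → ℝ} (hp1 : 1 ≤ p) (hp2 : p < 2)
    (hg : MemDual a b p g) (hh : HasBoundedPVariation a b p h) {η : ℝ} (hη : 0 < η) :
    ∃ δ > 0, ∀ (κ : IntervalPartition a b) (S : Finset ℕ), S ⊆ Finset.range κ.n →
      (∀ i ∈ S, |g (κ.pt (i + 1)) - g (κ.pt i)| ≤ δ ∧ |h (κ.pt (i + 1)) - h (κ.pt i)| ≤ δ) →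
      ∑ i ∈ S, mixedIncr g h (κ.pt i) (κ.pt (i + 1)) ≤ η := by
  obtain ⟨K, hK0, hK⟩ := hh.exists_sum_le
  rcases hg with ⟨rfl, -⟩ | ⟨hp1, q, hq, hpq, hg⟩
  -- For `p = 1` each term is at most `3δ |Δh|`: twice from the product, once from the square. The
  -- `+ 1` allows `K = 0`.
  · refine ⟨η / (3 * (K + 1)), by positivity, fun κ S hS hsmall => ?_⟩
    calc ∑ i ∈ S, mixedIncr g h (κ.pt i) (κ.pt (i + 1))
        ≤ ∑ i ∈ S, 3 * (η / (3 * (K + 1))) * |h (κ.pt (i + 1)) - h (κ.pt i)| ^ (1 : ℝ) := by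
          refine Finset.sum_le_sum fun i hi => ?_
          obtain ⟨h1, h2⟩ := hsmall i hi
          rw [mixedIncr, ← sq_abs (h (κ.pt (i + 1)) - h (κ.pt i)), Real.rpow_one]
          nlinarith [abs_nonneg (h (κ.pt (i + 1)) - h (κ.pt i))]
      _ ≤ 3 * (η / (3 * (K + 1))) * K := by
          rw [← Finset.mul_sum]
          exact mul_le_mul_of_nonneg_left (hK κ S hS) (by positivity)
      _ ≤ η := by
          rw [show 3 * (η / (3 * (K + 1))) * K = η * (K / (K + 1)) by field_simp]
          refine mul_le_of_le_one_right hη.le ?_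
          rw [div_le_one (by positivity)]
          linarith
  · obtain ⟨K', hK0', hK'⟩ := hg.exists_sum_le
    have hp0 : 0 < p := by linarith
    -- This is the final bound as a function of `δ`; it vanishes at `0` because `1/p + 1/q > 1` and
    -- `p < 2`.
    have hlim : Tendsto (fun δ : ℝ => 2 * ((δ ^ q + δ ^ p) ^ (1 / p + 1 / q - 1) * (K' + K)) +
        δ ^ (2 - p) * K) (𝓝[>] 0) (𝓝 0) := by
      have e : ∀ r : ℝ, 0 < r → Tendsto (fun δ : ℝ => δ ^ r) (𝓝 0) (𝓝 0) := fun r hr => by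
        have := (Real.continuousAt_rpow_const (0 : ℝ) r (Or.inr hr.le)).tendsto
        rwa [Real.zero_rpow hr.ne'] at this
      have h1 := (e q hq).add (e p hp0)
      rw [add_zero] at h1
      have h2 := (((e (1 / p + 1 / q - 1) (by linarith)).comp h1).mul_const (K' + K)).const_mul 2
      have h3 := h2.add ((e (2 - p) (by linarith)).mul_const K)
      simp only [zero_mul, mul_zero, add_zero] at h3
      exact h3.mono_left nhdsWithin_le_nhds
    obtain ⟨δ, hδ, hδ0⟩ := ((hlim.eventually_lt_const hη).and self_mem_nhdsWithin).exists
    have hδ0 : 0 < δ := hδ0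
    refine ⟨δ, hδ0, fun κ S hS hsmall => le_trans ?_ hδ.le⟩
    calc ∑ i ∈ S, mixedIncr g h (κ.pt i) (κ.pt (i + 1))
        ≤ ∑ i ∈ S, (2 * ((δ ^ q + δ ^ p) ^ (1 / p + 1 / q - 1) *
            (|g (κ.pt (i + 1)) - g (κ.pt i)| ^ q + |h (κ.pt (i + 1)) - h (κ.pt i)| ^ p)) +
            δ ^ (2 - p) * |h (κ.pt (i + 1)) - h (κ.pt i)| ^ p) := by
          refine Finset.sum_le_sum fun i hi => ?_
          obtain ⟨h1, h2⟩ := hsmall i hi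
          rw [mixedIncr, ← sq_abs (h (κ.pt (i + 1)) - h (κ.pt i))]
          exact add_le_add (mul_le_mul_of_nonneg_left (mul_le_rpow_mul_add hp0 hq hpq.le
            (abs_nonneg _) (abs_nonneg _) h1 h2) zero_le_two)
            (sq_le_rpow_mul hp0 hp2.le (abs_nonneg _) h2)
      _ ≤ _ := by
          rw [Finset.sum_add_distrib, ← Finset.mul_sum, ← Finset.mul_sum, ← Finset.mul_sum,
            Finset.sum_add_distrib]
          have h1 := hK κ S hS
          have h2 := hK' κ S hS
          gcongr

/-! ### Constructing a bracket function. -/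

namespace IsRegulated

variable {a b : ℝ} {F : ℝ → ℝ}

/-- Close to `t` on the left, both `F s` and `F(s+)` are near `F(t-)`. This disposes of the jump at
the moving endpoint when one-sided limits of the bracket are computed. -/
theorem tendsto_rightJump_left (hF : IsRegulated a b F) {t : ℝ} (ht : t ∈ Set.Ioc a b) :
    Tendsto (rightJump F) (𝓝[<] t) (𝓝 0) := by
  rw [Metric.tendsto_nhds]
  intro ε hε
  have h1 := (Metric.tendsto_nhds.1 (hF.tendsto_left ht)) (ε / 3) (by linarith)
  obtain ⟨z, hz, hz'⟩ := mem_nhdsLT_iff_exists_Ioo_subset.1 h1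
  filter_upwards [Ioo_mem_nhdsLT (max_lt hz ht.1)] with s hs
  have hs1 : z < s := (le_max_left z a).trans_lt hs.1
  have hs2 : a < s := (le_max_right z a).trans_lt hs.1
  have h2 := hF.tendsto_right ⟨hs2.le, hs.2.trans_le ht.2⟩
  have h3 : dist (Function.rightLim F s) (Function.leftLim F t) ≤ ε / 3 := by
    refine le_of_tendsto (h2.dist tendsto_const_nhds) ?_
    filter_upwards [Ioo_mem_nhdsGT hs.2] with y hy
    exact le_of_lt (hz' ⟨hs1.trans hy.1, hy.2⟩)
  have h4 : dist (F s) (Function.leftLim F t) < ε / 3 := hz' ⟨hs1, hs.2⟩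
  rw [rightJump, Real.dist_eq, sub_zero, ← Real.dist_eq]
  have := dist_triangle_right (Function.rightLim F s) (F s) (Function.leftLim F t)
  linarith

theorem tendsto_leftJump_right (hF : IsRegulated a b F) {t : ℝ} (ht : t ∈ Set.Ico a b) :
    Tendsto (leftJump F) (𝓝[>] t) (𝓝 0) := by
  rw [Metric.tendsto_nhds]
  intro ε hε
  have h1 := (Metric.tendsto_nhds.1 (hF.tendsto_right ht)) (ε / 3) (by linarith)
  obtain ⟨z, hz, hz'⟩ := mem_nhdsGT_iff_exists_Ioo_subset.1 h1
  filter_upwards [Ioo_mem_nhdsGT (lt_min hz ht.2)] with s hs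
  have hs1 : s < z := hs.2.trans_le (min_le_left z b)
  have hs2 : s < b := hs.2.trans_le (min_le_right z b)
  have h2 := hF.tendsto_left ⟨ht.1.trans_lt hs.1, hs2.le⟩
  have h3 : dist (Function.leftLim F s) (Function.rightLim F t) ≤ ε / 3 := by
    refine le_of_tendsto (h2.dist tendsto_const_nhds) ?_
    filter_upwards [Ioo_mem_nhdsLT hs.1] with y hy
    exact le_of_lt (hz' ⟨hy.1, hy.2.trans hs1⟩)
  have h4 : dist (F s) (Function.rightLim F t) < ε / 3 := hz' ⟨hs.1, hs1⟩
  rw [leftJump, Real.dist_eq, sub_zero, ← Real.dist_eq]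
  have := dist_triangle_right (F s) (Function.leftLim F s) (Function.rightLim F t)
  linarith

/-- A criterion for the existence of a bracket function. -/
theorem exists_isBracket (hF : IsRegulated a b F) (lam : NestedPartitions a b)
    (hjump : ∀ x ∈ Set.Ioo a b, x ∉ lam.points → leftJump F x * rightJump F x = 0)
    (hlim : ∀ s t, a ≤ s → s < t → t ≤ b →
      ∃ l, Tendsto (fun m => (lam.part m).sqSum F s t) atTop (𝓝 l))
    (hleft : ∀ t ∈ Set.Ioc a b, ∀ η > 0, ∀ᶠ s in 𝓝[<] t, ∀ᶠ m in atTop,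
      (lam.part m).innerSum (fun x y => (F y - F x) ^ 2) s t ≤ η)
    (hright : ∀ s ∈ Set.Ico a b, ∀ η > 0, ∀ᶠ t in 𝓝[>] s, ∀ᶠ m in atTop,
      (lam.part m).innerSum (fun x y => (F y - F x) ^ 2) s t ≤ η) :
    ∃ W, IsBracket lam F W := by
  have hex : ∀ t, ∃ w, (a < t → t ≤ b →
      Tendsto (fun m => (lam.part m).sqSum F a t) atTop (𝓝 w)) ∧ (t ≤ a → w = 0) := by
    intro t
    by_cases ht : a < t ∧ t ≤ b
    · obtain ⟨l, hl⟩ := hlim a t le_rfl ht.1 ht.2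
      exact ⟨l, fun _ _ => hl, fun h => absurd ht.1 (not_lt.2 h)⟩
    · exact ⟨0, fun h1 h2 => absurd ⟨h1, h2⟩ ht, fun _ => rfl⟩
  choose W hW hW0 using hex
  have hsq : ∀ s t, a ≤ s → s < t → t ≤ b →
      Tendsto (fun m => (lam.part m).sqSum F s t) atTop (𝓝 (W t - W s)) := by
    intro s t has hst htb
    rcases has.eq_or_lt with rfl | has
    · rw [hW0 a le_rfl, sub_zero]
      exact hW t hst htb
    · have h1 := hW t (has.trans hst) htb
      have h2 := hW s has (hst.le.trans htb)
      have h3 := hF.tendsto_sqSum_sub_sub lam le_rfl has hst htb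
        (hjump s ⟨has, hst.trans_le htb⟩)
      have h4 := (h1.sub h2).sub h3
      rw [sub_zero] at h4
      refine h4.congr fun m => ?_
      ring
  have hinner : ∀ s t, a ≤ s → s < t → t ≤ b →
      Tendsto (fun m => (lam.part m).innerSum (fun x y => (F y - F x) ^ 2) s t) atTop
        (𝓝 (W t - W s - (rightJump F s ^ 2 + leftJump F t ^ 2))) := by
    intro s t has hst htb
    refine ((hsq s t has hst htb).sub
      (hF.tendsto_sqSum_sub_innerSum lam has hst htb)).congr fun m => ?_
    ring
  have hinner0 : ∀ s t, a ≤ s → s < t → t ≤ b →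
      0 ≤ W t - W s - (rightJump F s ^ 2 + leftJump F t ^ 2) := fun s t has hst htb =>
    ge_of_tendsto' (hinner s t has hst htb) fun m =>
      (lam.part m).innerSum_nonneg (fun _ _ => sq_nonneg _) _ _
  have hWl : ∀ t ∈ Set.Ioc a b, Tendsto W (𝓝[<] t) (𝓝 (W t - leftJump F t ^ 2)) := by
    intro t ht
    rw [Metric.tendsto_nhds]
    intro ε hε
    -- The limit of the inner sums, `W t - W s` minus both squared jumps, lies in `[0, ε/3]`, and
    -- the squared jump at `s` is below `ε/2`; only the jump at `t` survives.
    have h1 := ((hF.tendsto_rightJump_left ht).pow 2).eventually_lt_const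
      (show (0 : ℝ) ^ 2 < ε / 2 by linarith)
    filter_upwards [h1, hleft t ht (ε / 3) (by linarith), Ioo_mem_nhdsLT ht.1] with s hs1 hs2 hs3
    have h2 := le_of_tendsto (hinner s t hs3.1.le hs3.2 ht.2) hs2
    have h3 := hinner0 s t hs3.1.le hs3.2 ht.2
    rw [Real.dist_eq, abs_lt]
    have h4 := sq_nonneg (rightJump F s)
    constructor <;> linarith
  have hWr : ∀ s ∈ Set.Ico a b, Tendsto W (𝓝[>] s) (𝓝 (W s + rightJump F s ^ 2)) := by
    intro s hs
    rw [Metric.tendsto_nhds]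
    intro ε hε
    have h1 := ((hF.tendsto_leftJump_right hs).pow 2).eventually_lt_const
      (show (0 : ℝ) ^ 2 < ε / 2 by linarith)
    filter_upwards [h1, hright s hs (ε / 3) (by linarith), Ioo_mem_nhdsGT hs.2]
      with t ht1 ht2 ht3
    have h2 := le_of_tendsto (hinner s t hs.1 ht3.1 ht3.2.le) ht2
    have h3 := hinner0 s t hs.1 ht3.1 ht3.2.le
    rw [Real.dist_eq, abs_lt]
    have h4 := sq_nonneg (leftJump F t)
    constructor <;> linarith
  refine ⟨W, ⟨fun t ht => ⟨_, hWl t ht⟩, fun s hs => ⟨_, hWr s hs⟩⟩, hW0 a le_rfl, hsq, ?_, ?_⟩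
  · intro t ht
    rw [leftJump_eq_of_tendsto (hWl t ht)]
    ring
  · intro s hs
    rw [rightJump_eq_of_tendsto (hWr s hs)]
    ring

end IsRegulated

/-! ### Approximation by convergent sequences, and gluing. -/

/-- A sequence that is eventually close to convergent sequences converges. -/
theorem exists_tendsto_of_forall_approx {A : ℕ → ℝ}
    (h : ∀ η > 0, ∃ (B : ℕ → ℝ) (l : ℝ), Tendsto B atTop (𝓝 l) ∧
      ∀ᶠ m in atTop, |A m - B m| ≤ η) : ∃ l, Tendsto A atTop (𝓝 l) := by
  refine cauchySeq_tendsto_of_complete (Metric.cauchySeq_iff'.2 fun ε hε => ?_)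
  obtain ⟨B, l, hB, hAB⟩ := h (ε / 5) (by linarith)
  obtain ⟨N, hN⟩ := eventually_atTop.1
    (hAB.and ((Metric.tendsto_nhds.1 hB) (ε / 5) (by linarith)))
  refine ⟨N, fun n hn => ?_⟩
  obtain ⟨h1, h2⟩ := hN n hn
  obtain ⟨h3, h4⟩ := hN N le_rfl
  rw [Real.dist_eq] at *
  rw [abs_le] at h1 h3
  rw [abs_lt] at *
  constructor <;> linarith

/-- The sums of squares of `F` over `[u, v]` are approximated by a convergent sequence, with an
error controlled by the interval function `e`. -/
def ApproxSqSum {a b : ℝ} (lam : NestedPartitions a b) (F : ℝ → ℝ) (e : ℝ → ℝ → ℝ)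
    (u v : ℝ) : Prop :=
  ∃ (B : ℕ → ℝ) (l : ℝ), Tendsto B atTop (𝓝 l) ∧
    ∀ᶠ m in atTop, |(lam.part m).sqSum F u v - B m| ≤ (lam.part m).innerSum e u v

/-- The cross term at `x` tends to zero and is absorbed into the approximating sequence; the two
errors add up by superadditivity. -/
theorem ApproxSqSum.glue {a b : ℝ} {lam : NestedPartitions a b} {F : ℝ → ℝ} {e : ℝ → ℝ → ℝ}
    (hF : IsRegulated a b F) (he : ∀ x y, 0 ≤ e x y) {u x v : ℝ}
    (hu : a ≤ u) (hux : u < x) (hxv : x < v) (hv : v ≤ b)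
    (hx : x ∉ lam.points → leftJump F x * rightJump F x = 0)
    (h1 : ApproxSqSum lam F e u x) (h2 : ApproxSqSum lam F e x v) :
    ApproxSqSum lam F e u v := by
  obtain ⟨B₁, l₁, hB₁, hA₁⟩ := h1
  obtain ⟨B₂, l₂, hB₂, hA₂⟩ := h2
  refine ⟨_, _, (hF.tendsto_sqSum_sub_sub lam hu hux hxv hv hx).add (hB₁.add hB₂), ?_⟩
  filter_upwards [hA₁, hA₂] with m hm1 hm2
  refine le_trans ?_ ((lam.part m).innerSum_add_innerSum_le he hux.le hxv.le)
  refine le_trans ?_ (add_le_add hm1 hm2)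
  refine le_of_eq_of_le ?_ (abs_add_le _ _)
  congr 1
  ring

/-! ### Comparing squared increments of `φ ∘ f` and `g`. -/

theorem exists_mem_uIcc_sub_eq_deriv_mul {φ : ℝ → ℝ} (hφ : Differentiable ℝ φ) (x y : ℝ) :
    ∃ ξ ∈ Set.uIcc x y, φ y - φ x = deriv φ ξ * (y - x) := by
  rcases lt_trichotomy x y with h | rfl | h
  · obtain ⟨ξ, hξ, he⟩ := exists_deriv_eq_slope φ h hφ.continuous.continuousOn
      hφ.differentiableOn
    refine ⟨ξ, Set.Icc_subset_uIcc (Set.Ioo_subset_Icc_self hξ), ?_⟩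
    rw [he, div_mul_cancel₀ _ (sub_pos.2 h).ne']
  · exact ⟨x, Set.left_mem_uIcc, by simp⟩
  · obtain ⟨ξ, hξ, he⟩ := exists_deriv_eq_slope φ h hφ.continuous.continuousOn
      hφ.differentiableOn
    refine ⟨ξ, Set.Icc_subset_uIcc' (Set.Ioo_subset_Icc_self hξ), ?_⟩
    have := (sub_pos.2 h).ne'
    rw [he]
    field_simp
    ring

theorem sq_sub_sq_le_mixedIncr {g h f : ℝ → ℝ} {x y : ℝ}
    (hf : f y - f x = g y - g x + (h y - h x)) :
    |(f y - f x) ^ 2 - (g y - g x) ^ 2| ≤ mixedIncr g h x y := by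
  rw [hf, mixedIncr, ← abs_mul, show (g y - g x + (h y - h x)) ^ 2 - (g y - g x) ^ 2 =
    2 * ((g y - g x) * (h y - h x)) + (h y - h x) ^ 2 by ring]
  refine (abs_add_le _ _).trans (le_of_eq ?_)
  rw [abs_mul 2, abs_two, abs_of_nonneg (sq_nonneg (h y - h x))]

/-- Comparison of the squared increments of `φ ∘ f` and of `g`, for `f = C + g + h`. -/
theorem abs_comp_sq_sub_le {φ f g h : ℝ → ℝ} (hφ : Differentiable ℝ φ) {x y k ω K : ℝ}
    (hf : f y - f x = g y - g x + (h y - h x)) (hω : 0 ≤ ω) (hk : 0 ≤ k) (hkK : k ≤ K)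
    (hd : ∀ ξ ∈ Set.uIcc (f x) (f y), |deriv φ ξ ^ 2 - k| ≤ ω) :
    |((φ ∘ f) y - (φ ∘ f) x) ^ 2 - k * (g y - g x) ^ 2| ≤
      ω * (g y - g x) ^ 2 + (ω + K) * mixedIncr g h x y := by
  obtain ⟨ξ, hξ, he⟩ := exists_mem_uIcc_sub_eq_deriv_mul hφ (f x) (f y)
  have h1 := sq_sub_sq_le_mixedIncr hf
  have h2 : (f y - f x) ^ 2 ≤ (g y - g x) ^ 2 + mixedIncr g h x y := by
    linarith [(abs_le.1 h1).2]
  -- First freeze `φ'(ξ)²` at `k`, then replace `f` by `g`.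
  have e : ((φ ∘ f) y - (φ ∘ f) x) ^ 2 - k * (g y - g x) ^ 2 =
      (deriv φ ξ ^ 2 - k) * (f y - f x) ^ 2 + k * ((f y - f x) ^ 2 - (g y - g x) ^ 2) := by
    simp only [Function.comp_apply]
    rw [he]
    ring
  rw [e]
  refine (abs_add_le _ _).trans ?_
  rw [abs_mul, abs_mul, abs_of_nonneg (sq_nonneg (f y - f x)), abs_of_nonneg hk]
  have h3 : |deriv φ ξ ^ 2 - k| * (f y - f x) ^ 2 ≤
      ω * ((g y - g x) ^ 2 + mixedIncr g h x y) :=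
    mul_le_mul (hd ξ hξ) h2 (sq_nonneg _) hω
  have h4 : k * |(f y - f x) ^ 2 - (g y - g x) ^ 2| ≤ K * mixedIncr g h x y :=
    mul_le_mul hkK h1 (abs_nonneg _) (hk.trans hkK)
  linarith

open Classical in
/-- The error in `abs_comp_sq_sub_le`, for intervals on which the increments of `g` and `h` are at
most `δ`. -/
noncomputable def incrError (ω K δ : ℝ) (g h : ℝ → ℝ) (x y : ℝ) : ℝ :=
  if |g y - g x| ≤ δ ∧ |h y - h x| ≤ δ then
    ω * (g y - g x) ^ 2 + (ω + K) * mixedIncr g h x y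
  else 0

theorem incrError_nonneg {ω K δ : ℝ} (hω : 0 ≤ ω) (hK : 0 ≤ K) (g h : ℝ → ℝ) (x y : ℝ) :
    0 ≤ incrError ω K δ g h x y := by
  unfold incrError
  have := mixedIncr_nonneg g h x y
  split_ifs <;> positivity

section

variable {a b : ℝ} {φ f g h : ℝ → ℝ} {C : ℝ}

theorem sub_eq_of_eq_const_add (hf : ∀ t ∈ Set.Icc a b, f t = C + g t + h t) {x y : ℝ}
    (hx : x ∈ Set.Icc a b) (hy : y ∈ Set.Icc a b) :
    f y - f x = g y - g x + (h y - h x) := by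
  rw [hf x hx, hf y hy]; ring

theorem IntervalPartition.mem_Ioo_of_mem_inner (κ : IntervalPartition a b) {u v : ℝ} {i : ℕ}
    (hi : i ∈ κ.inner u v) :
    κ.pt i ∈ Set.Icc a b ∩ Set.Ioo u v ∧ κ.pt (i + 1) ∈ Set.Icc a b ∩ Set.Ioo u v := by
  obtain ⟨h1, h2, h3⟩ := κ.mem_inner.1 hi
  have h4 := κ.pt_lt_pt (Nat.lt_succ_self i) h1
  exact ⟨⟨κ.pt_mem_Icc h1.le, h2, h4.trans h3⟩, ⟨κ.pt_mem_Icc h1, h2.trans h4, h3⟩⟩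

theorem IntervalPartition.innerSum_sq_le_sqSum (κ : IntervalPartition a b) (g : ℝ → ℝ)
    {u v : ℝ} : κ.innerSum (fun x y => (g y - g x) ^ 2) u v ≤ κ.sqSum g a b := by
  rw [κ.sqSum_self]
  exact Finset.sum_le_sum_of_subset_of_nonneg (Finset.filter_subset _ _)
    fun _ _ _ => sq_nonneg _

/-- The cut-off in `incrError` retains exactly the intervals to which the smallness bound applies,
so the estimate holds on every `(u, v)`, however large the oscillation there. -/
theorem IntervalPartition.innerSum_incrError_le (κ : IntervalPartition a b) {ω K δ η : ℝ}
    (hω : 0 ≤ ω) (hK : 0 ≤ K)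
    (hη : ∀ S : Finset ℕ, S ⊆ Finset.range κ.n →
      (∀ i ∈ S, |g (κ.pt (i + 1)) - g (κ.pt i)| ≤ δ ∧ |h (κ.pt (i + 1)) - h (κ.pt i)| ≤ δ) →
      ∑ i ∈ S, mixedIncr g h (κ.pt i) (κ.pt (i + 1)) ≤ η) (u v : ℝ) :
    κ.innerSum (incrError ω K δ g h) u v ≤
      ω * κ.innerSum (fun x y => (g y - g x) ^ 2) u v + (ω + K) * η := by
  classical
  unfold innerSum incrError
  rw [← Finset.sum_filter, Finset.sum_add_distrib, ← Finset.mul_sum, ← Finset.mul_sum]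
  refine add_le_add (mul_le_mul_of_nonneg_left ?_ hω) (mul_le_mul_of_nonneg_left ?_ (by positivity))
  · exact Finset.sum_le_sum_of_subset_of_nonneg (Finset.filter_subset _ _)
      fun _ _ _ => sq_nonneg _
  · exact hη _ ((Finset.filter_subset _ _).trans (Finset.filter_subset _ _))
      fun i hi => (Finset.mem_filter.1 hi).2

/-- On an interval of small oscillation the inner sums of squares of `φ ∘ f` and of `g` are
comparable. -/
theorem IntervalPartition.abs_innerSum_comp_sub_le (κ : IntervalPartition a b)
    (hφ : Differentiable ℝ φ) (hf : ∀ t ∈ Set.Icc a b, f t = C + g t + h t)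
    {u v k ω K δ gr hr : ℝ} {U : Set ℝ} (hU : Convex ℝ U) (hω : 0 ≤ ω) (hk : 0 ≤ k)
    (hkK : k ≤ K) (hd : ∀ ξ ∈ U, |deriv φ ξ ^ 2 - k| ≤ ω)
    (hosc : ∀ y ∈ Set.Icc a b ∩ Set.Ioo u v, |g y - gr| ≤ δ / 2 ∧ |h y - hr| ≤ δ / 2 ∧ f y ∈ U) :
    |κ.innerSum (fun x y => ((φ ∘ f) y - (φ ∘ f) x) ^ 2) u v -
      k * κ.innerSum (fun x y => (g y - g x) ^ 2) u v| ≤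
      κ.innerSum (incrError ω K δ g h) u v := by
  unfold innerSum
  rw [Finset.mul_sum, ← Finset.sum_sub_distrib]
  refine (Finset.abs_sum_le_sum_abs _ _).trans (Finset.sum_le_sum fun i hi => ?_)
  obtain ⟨hx, hy⟩ := κ.mem_Ioo_of_mem_inner hi
  obtain ⟨gx, hx', fx⟩ := hosc _ hx
  obtain ⟨gy, hy', fy⟩ := hosc _ hy
  rw [abs_le] at gx hx' gy hy'
  have hs : |g (κ.pt (i + 1)) - g (κ.pt i)| ≤ δ ∧ |h (κ.pt (i + 1)) - h (κ.pt i)| ≤ δ := by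
    constructor <;> rw [abs_le] <;> constructor <;> linarith
  rw [incrError, if_pos hs]
  exact abs_comp_sq_sub_le hφ (sub_eq_of_eq_const_add hf hx.1 hy.1) hω hk hkK
    fun ξ hξ => hd ξ (hU.ordConnected.uIcc_subset fx fy hξ)

/-! ### Existence of the quadratic variation of `φ ∘ f`. -/

theorem approxSqSum_of_oscillation {lam : NestedPartitions a b} {V : ℝ → ℝ}
    (hφ : Differentiable ℝ φ) (hf : ∀ t ∈ Set.Icc a b, f t = C + g t + h t)
    (hF : IsRegulated a b (φ ∘ f)) (hg : IsRegulated a b g) (hV : IsBracket lam g V)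
    {u v k ω K δ gr hr : ℝ} {U : Set ℝ} (hU : Convex ℝ U) (hω : 0 ≤ ω) (hk : 0 ≤ k)
    (hkK : k ≤ K) (hd : ∀ ξ ∈ U, |deriv φ ξ ^ 2 - k| ≤ ω)
    (hosc : ∀ y ∈ Set.Icc a b ∩ Set.Ioo u v, |g y - gr| ≤ δ / 2 ∧ |h y - hr| ≤ δ / 2 ∧ f y ∈ U)
    (hu : a ≤ u) (huv : u < v) (hv : v ≤ b) :
    ApproxSqSum lam (φ ∘ f) (incrError ω K δ g h) u v := by
  have h1 := hF.tendsto_sqSum_sub_innerSum lam hu huv hv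
  have h2 := (hV.2.2.1 u v hu huv hv).sub (hg.tendsto_sqSum_sub_innerSum lam hu huv hv)
  -- The approximant is the end contribution of `φ ∘ f` plus `k` times the inner sum of `g`; the
  -- latter converges since `g` has a bracket.
  refine ⟨_, _, h1.add (h2.const_mul k), Eventually.of_forall fun m => ?_⟩
  refine le_of_eq_of_le ?_
    ((lam.part m).abs_innerSum_comp_sub_le hφ hf hU hω hk hkK hd hosc)
  congr 1
  ring

theorem IsRegulated.eventually_left (hg : IsRegulated a b g) {x ε : ℝ}
    (hx : x ∈ Set.Ioc a b) (hε : 0 < ε) :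
    ∀ᶠ y in 𝓝[<] x, |g y - Function.leftLim g x| < ε :=
  Metric.tendsto_nhds.1 (hg.tendsto_left hx) ε hε

theorem IsRegulated.eventually_right (hg : IsRegulated a b g) {x ε : ℝ}
    (hx : x ∈ Set.Ico a b) (hε : 0 < ε) :
    ∀ᶠ y in 𝓝[>] x, |g y - Function.rightLim g x| < ε :=
  Metric.tendsto_nhds.1 (hg.tendsto_right hx) ε hε

theorem approxSqSum_comp {lam : NestedPartitions a b} {V : ℝ → ℝ}
    (hφ : ContDiff ℝ 1 φ) (hf : ∀ t ∈ Set.Icc a b, f t = C + g t + h t)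
    (hfr : IsRegulated a b f) (hg : IsRegulated a b g) (hh : IsRegulated a b h)
    (hV : IsBracket lam g V)
    (hjump : ∀ x ∈ Set.Ioo a b, x ∉ lam.points →
      leftJump (φ ∘ f) x * rightJump (φ ∘ f) x = 0)
    {M K ω δ : ℝ} (hM : ∀ x ∈ Set.Icc a b, f x ∈ Set.Icc (-M) M)
    (hK : ∀ ξ ∈ Set.Icc (-M) M, deriv φ ξ ^ 2 ≤ K) (hK0 : 0 ≤ K)
    (hω : 0 < ω) (hδ : 0 < δ) {u v : ℝ} (hu : a ≤ u) (huv : u < v) (hv : v ≤ b) :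
    ApproxSqSum lam (φ ∘ f) (incrError ω K δ g h) u v := by
  have hF : IsRegulated a b (φ ∘ f) := hfr.comp hφ.continuous
  have hdiff : Differentiable ℝ φ := hφ.differentiable one_ne_zero
  have hd : Continuous fun ξ => deriv φ ξ ^ 2 := (hφ.continuous_deriv le_rfl).pow 2
  refine forall_Icc_of_local (a := a) (b := b)
    -- The bounds are part of the property because the local hypotheses do not confine the interval
    -- to `[a, b]`.
    (P := fun u v => a ≤ u → v ≤ b → ApproxSqSum lam (φ ∘ f) (incrError ω K δ g h) u v)
    ?_ ?_ ?_ hu huv hv hu hv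
  · intro u x v hu hux hxv hv h1 h2 _ _
    exact ApproxSqSum.glue hF (incrError_nonneg hω.le hK0 g h) hu hux hxv hv
      (hjump x ⟨hu.trans_lt hux, hxv.trans_le hv⟩) (h1 hu (hxv.le.trans hv))
      (h2 (hu.trans hux.le) hv)
  · intro x hx
    -- Here `k` is `φ'(f(x+))²`. The one-sided limit stays in the closed interval `[-M, M]`, so `k ≤
    -- K`.
    obtain ⟨ρ, hρ, hρ'⟩ := Metric.continuous_iff.1 hd (Function.rightLim f x) ω hω
    have hmem : Function.rightLim f x ∈ Set.Icc (-M) M := by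
      refine isClosed_Icc.mem_of_tendsto (hfr.tendsto_right hx) ?_
      filter_upwards [Ioo_mem_nhdsGT hx.2] with y hy
      exact hM y ⟨hx.1.trans hy.1.le, hy.2.le⟩
    have hev := (hg.eventually_right hx (half_pos hδ)).and
      ((hh.eventually_right hx (half_pos hδ)).and (hfr.eventually_right hx hρ))
    obtain ⟨z, hz, hz'⟩ := mem_nhdsGT_iff_exists_Ioo_subset.1 hev
    filter_upwards [Ioo_mem_nhdsGT hz] with y hy u v hxu huv hvy hau hvb
    refine approxSqSum_of_oscillation hdiff hf hF hg hV (gr := Function.rightLim g x)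
      (hr := Function.rightLim h x) (convex_ball (Function.rightLim f x) ρ)
      hω.le (sq_nonneg _) (hK _ hmem) (fun ξ hξ => (hρ' ξ hξ).le) ?_ hau huv hvb
    intro t ht
    obtain ⟨h1, h2, h3⟩ := hz' ⟨hxu.trans_lt ht.2.1, ht.2.2.trans (hvy.trans_lt hy.2)⟩
    exact ⟨h1.le, h2.le, h3⟩
  · intro x hx
    obtain ⟨ρ, hρ, hρ'⟩ := Metric.continuous_iff.1 hd (Function.leftLim f x) ω hω
    have hmem : Function.leftLim f x ∈ Set.Icc (-M) M := by
      refine isClosed_Icc.mem_of_tendsto (hfr.tendsto_left hx) ?_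
      filter_upwards [Ioo_mem_nhdsLT hx.1] with y hy
      exact hM y ⟨hy.1.le, hy.2.le.trans hx.2⟩
    have hev := (hg.eventually_left hx (half_pos hδ)).and
      ((hh.eventually_left hx (half_pos hδ)).and (hfr.eventually_left hx hρ))
    obtain ⟨z, hz, hz'⟩ := mem_nhdsLT_iff_exists_Ioo_subset.1 hev
    filter_upwards [Ioo_mem_nhdsLT hz] with y hy u v hyu huv hvx hau hvb
    refine approxSqSum_of_oscillation hdiff hf hF hg hV (gr := Function.leftLim g x)
      (hr := Function.leftLim h x) (convex_ball (Function.leftLim f x) ρ)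
      hω.le (sq_nonneg _) (hK _ hmem) (fun ξ hξ => (hρ' ξ hξ).le) ?_ hau huv hvb
    intro t ht
    obtain ⟨h1, h2, h3⟩ := hz' ⟨hy.1.trans (hyu.trans_lt ht.2.1), ht.2.2.trans_le hvx⟩
    exact ⟨h1.le, h2.le, h3⟩

theorem exists_tendsto_sqSum_comp {lam : NestedPartitions a b} {V : ℝ → ℝ} {p : ℝ} (hab : a < b)
    (hp1 : 1 ≤ p) (hp2 : p < 2)
    (hφ : ContDiff ℝ 1 φ) (hf : ∀ t ∈ Set.Icc a b, f t = C + g t + h t)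
    (hfr : IsRegulated a b f) (hg : IsRegulated a b g) (hh : IsRegulated a b h)
    (hV : IsBracket lam g V) (hgd : MemDual a b p g) (hhp : HasBoundedPVariation a b p h)
    (hjump : ∀ x ∈ Set.Ioo a b, x ∉ lam.points →
      leftJump (φ ∘ f) x * rightJump (φ ∘ f) x = 0)
    {M K : ℝ} (hM : ∀ x ∈ Set.Icc a b, f x ∈ Set.Icc (-M) M)
    (hK : ∀ ξ ∈ Set.Icc (-M) M, deriv φ ξ ^ 2 ≤ K) (hK0 : 0 ≤ K)
    {s t : ℝ} (hs : a ≤ s) (hst : s < t) (ht : t ≤ b) :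
    ∃ l, Tendsto (fun m => (lam.part m).sqSum (φ ∘ f) s t) atTop (𝓝 l) := by
  refine exists_tendsto_of_forall_approx fun η hη => ?_
  -- `T` eventually bounds the full sum of squares of `g`. First `ω` and then `δ` are chosen so that
  -- the two error terms, `ω T` and `(ω + K) · η / (2 (ω + K))`, are each `η / 2`.
  set T := |V b - V a| + 1 with hT
  have hT0 : 0 < T := by positivity
  set ω := η / (2 * T) with hω
  have hω0 : 0 < ω := by positivity
  obtain ⟨δ, hδ, hsmall⟩ := exists_sum_mixedIncr_le hp1 hp2 hgd hhp
    (show 0 < η / (2 * (ω + K)) by positivity)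
  obtain ⟨B, l, hB, hAB⟩ := approxSqSum_comp hφ hf hfr hg hh hV hjump hM hK hK0 hω0 hδ hs hst ht
  refine ⟨B, l, hB, ?_⟩
  have hbd := (hV.2.2.1 a b le_rfl hab le_rfl).eventually_lt_const
    (show V b - V a < T by linarith [le_abs_self (V b - V a)])
  filter_upwards [hAB, hbd] with m hm1 hm2
  refine hm1.trans (((lam.part m).innerSum_incrError_le hω0.le hK0 (hsmall (lam.part m))
    s t).trans ?_)
  have h1 : ω * (lam.part m).innerSum (fun x y => (g y - g x) ^ 2) s t ≤ ω * T :=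
    mul_le_mul_of_nonneg_left
      (((lam.part m).innerSum_sq_le_sqSum g).trans hm2.le) hω0.le
  have h2 : ω * T = η / 2 := by rw [hω]; field_simp
  have h3 : (ω + K) * (η / (2 * (ω + K))) = η / 2 := by
    have : ω + K ≠ 0 := by positivity
    field_simp
  linarith

/-- This is the comparison with `k = 0` and `ω = K`, where no continuity of `φ'` is needed, only its
bound. -/
theorem innerSum_comp_le (κ : IntervalPartition a b) (hφ : Differentiable ℝ φ)
    (hf : ∀ t ∈ Set.Icc a b, f t = C + g t + h t)
    {M K δ η : ℝ} (hM : ∀ x ∈ Set.Icc a b, f x ∈ Set.Icc (-M) M)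
    (hK : ∀ ξ ∈ Set.Icc (-M) M, deriv φ ξ ^ 2 ≤ K) (hK0 : 0 ≤ K)
    (hη : ∀ S : Finset ℕ, S ⊆ Finset.range κ.n →
      (∀ i ∈ S, |g (κ.pt (i + 1)) - g (κ.pt i)| ≤ δ ∧ |h (κ.pt (i + 1)) - h (κ.pt i)| ≤ δ) →
      ∑ i ∈ S, mixedIncr g h (κ.pt i) (κ.pt (i + 1)) ≤ η) {u v gr hr : ℝ}
    (hosc : ∀ y ∈ Set.Icc a b ∩ Set.Ioo u v, |g y - gr| ≤ δ / 2 ∧ |h y - hr| ≤ δ / 2) :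
    κ.innerSum (fun x y => ((φ ∘ f) y - (φ ∘ f) x) ^ 2) u v ≤
      K * κ.innerSum (fun x y => (g y - g x) ^ 2) u v + K * η := by
  have h1 := κ.abs_innerSum_comp_sub_le hφ hf (k := 0) (ω := K) (K := 0) (convex_Icc (-M) M)
    hK0 le_rfl le_rfl
    (fun ξ hξ => by rw [sub_zero, abs_of_nonneg (sq_nonneg _)]; exact hK ξ hξ)
    (fun y hy => ⟨(hosc y hy).1, (hosc y hy).2, hM y hy.1⟩)
  have h2 := κ.innerSum_incrError_le hK0 le_rfl hη u v
  rw [zero_mul, sub_zero] at h1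
  rw [add_zero] at h2
  exact (le_abs_self _).trans (h1.trans h2)

/-- It suffices to make the inner sums of `g` small near `t`. Their limit is the increment of the
bracket minus the squared end jumps, and the jump of `V` at `t` cancels that of `g`. -/
theorem eventually_innerSum_comp_le_left {lam : NestedPartitions a b} {V : ℝ → ℝ} {p : ℝ}
    (hp1 : 1 ≤ p) (hp2 : p < 2)
    (hφ : Differentiable ℝ φ) (hf : ∀ t ∈ Set.Icc a b, f t = C + g t + h t)
    (hg : IsRegulated a b g) (hh : IsRegulated a b h)
    (hV : IsBracket lam g V) (hgd : MemDual a b p g) (hhp : HasBoundedPVariation a b p h)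
    {M K : ℝ} (hM : ∀ x ∈ Set.Icc a b, f x ∈ Set.Icc (-M) M)
    (hK : ∀ ξ ∈ Set.Icc (-M) M, deriv φ ξ ^ 2 ≤ K) (hK0 : 0 ≤ K)
    {t : ℝ} (ht : t ∈ Set.Ioc a b) {η : ℝ} (hη : 0 < η) :
    ∀ᶠ s in 𝓝[<] t, ∀ᶠ m in atTop,
      (lam.part m).innerSum (fun x y => ((φ ∘ f) y - (φ ∘ f) x) ^ 2) s t ≤ η := by
  set ε := η / (2 * (K + 1)) with hε
  have hε0 : 0 < ε := by positivity
  obtain ⟨δ, hδ, hsmall⟩ := exists_sum_mixedIncr_le hp1 hp2 hgd hhp hε0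
  have hev := (hg.eventually_left ht (half_pos hδ)).and (hh.eventually_left ht (half_pos hδ))
  obtain ⟨z, hz, hz'⟩ := mem_nhdsLT_iff_exists_Ioo_subset.1 hev
  filter_upwards [Ioo_mem_nhdsLT (max_lt hz ht.1), hV.1.eventually_left ht hε0] with s hs hVs
  have hs1 : z < s := (le_max_left z a).trans_lt hs.1
  have hs2 : a < s := (le_max_right z a).trans_lt hs.1
  have hl := (hV.2.2.1 s t hs2.le hs.2 ht.2).sub
    (hg.tendsto_sqSum_sub_innerSum lam hs2.le hs.2 ht.2)
  -- Since `(Δ⁻g(t))² = V(t) - V(t-)`, the left side is at most `V(t-) - V(s)`.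
  have hlt : V t - V s - (rightJump g s ^ 2 + leftJump g t ^ 2) < ε := by
    rw [← hV.2.2.2.1 t ht, leftJump]
    linarith [(abs_lt.1 hVs).1, sq_nonneg (rightJump g s)]
  filter_upwards [hl.eventually_lt_const hlt] with m hm
  rw [sub_sub_cancel] at hm
  have h1 := innerSum_comp_le (lam.part m) hφ hf hM hK hK0 (hsmall (lam.part m)) (u := s) (v := t)
    fun y hy => ⟨(hz' ⟨hs1.trans hy.2.1, hy.2.2⟩).1.le, (hz' ⟨hs1.trans hy.2.1, hy.2.2⟩).2.le⟩
  have h2 : (K + 1) * ε = η / 2 := by rw [hε]; field_simp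
  nlinarith

theorem eventually_innerSum_comp_le_right {lam : NestedPartitions a b} {V : ℝ → ℝ} {p : ℝ}
    (hp1 : 1 ≤ p) (hp2 : p < 2)
    (hφ : Differentiable ℝ φ) (hf : ∀ t ∈ Set.Icc a b, f t = C + g t + h t)
    (hg : IsRegulated a b g) (hh : IsRegulated a b h)
    (hV : IsBracket lam g V) (hgd : MemDual a b p g) (hhp : HasBoundedPVariation a b p h)
    {M K : ℝ} (hM : ∀ x ∈ Set.Icc a b, f x ∈ Set.Icc (-M) M)
    (hK : ∀ ξ ∈ Set.Icc (-M) M, deriv φ ξ ^ 2 ≤ K) (hK0 : 0 ≤ K)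
    {s : ℝ} (hs : s ∈ Set.Ico a b) {η : ℝ} (hη : 0 < η) :
    ∀ᶠ t in 𝓝[>] s, ∀ᶠ m in atTop,
      (lam.part m).innerSum (fun x y => ((φ ∘ f) y - (φ ∘ f) x) ^ 2) s t ≤ η := by
  set ε := η / (2 * (K + 1)) with hε
  have hε0 : 0 < ε := by positivity
  obtain ⟨δ, hδ, hsmall⟩ := exists_sum_mixedIncr_le hp1 hp2 hgd hhp hε0
  have hev := (hg.eventually_right hs (half_pos hδ)).and (hh.eventually_right hs (half_pos hδ))
  obtain ⟨z, hz, hz'⟩ := mem_nhdsGT_iff_exists_Ioo_subset.1 hev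
  filter_upwards [Ioo_mem_nhdsGT (lt_min hz hs.2), hV.1.eventually_right hs hε0] with t ht hVt
  have ht1 : t < z := ht.2.trans_le (min_le_left z b)
  have ht2 : t < b := ht.2.trans_le (min_le_right z b)
  have hl := (hV.2.2.1 s t hs.1 ht.1 ht2.le).sub
    (hg.tendsto_sqSum_sub_innerSum lam hs.1 ht.1 ht2.le)
  have hlt : V t - V s - (rightJump g s ^ 2 + leftJump g t ^ 2) < ε := by
    rw [← hV.2.2.2.2 s hs, rightJump]
    linarith [(abs_lt.1 hVt).2, sq_nonneg (leftJump g t)]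
  filter_upwards [hl.eventually_lt_const hlt] with m hm
  rw [sub_sub_cancel] at hm
  have h1 := innerSum_comp_le (lam.part m) hφ hf hM hK hK0 (hsmall (lam.part m)) (u := s) (v := t)
    fun y hy => ⟨(hz' ⟨hy.2.1, hy.2.2.trans ht1⟩).1.le, (hz' ⟨hy.2.1, hy.2.2.trans ht1⟩).2.le⟩
  have h2 : (K + 1) * ε = η / 2 := by rw [hε]; field_simp
  nlinarith

/-- If `(g, h)` is a dual pair, `f = C + g + h` and `φ` is `C¹`, then `φ ∘ f` has a bracket. -/
theorem exists_isBracket_comp {lam : NestedPartitions a b} {V : ℝ → ℝ} {p : ℝ} (hab : a < b)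
    (hp1 : 1 ≤ p) (hp2 : p < 2)
    (hφ : ContDiff ℝ 1 φ) (hf : ∀ t ∈ Set.Icc a b, f t = C + g t + h t)
    (hfr : IsRegulated a b f) (hg : IsRegulated a b g) (hh : IsRegulated a b h)
    (hV : IsBracket lam g V) (hgd : MemDual a b p g) (hhp : HasBoundedPVariation a b p h)
    (hjump : ∀ x ∈ Set.Ioo a b, x ∉ lam.points →
      leftJump (φ ∘ f) x * rightJump (φ ∘ f) x = 0) :
    ∃ W, IsBracket lam (φ ∘ f) W := by
  obtain ⟨M, hM⟩ := hfr.exists_bound hab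
  have hM' : ∀ x ∈ Set.Icc a b, f x ∈ Set.Icc (-M) M := fun x hx => abs_le.1 (hM x hx)
  have hdiff : Differentiable ℝ φ := hφ.differentiable one_ne_zero
  obtain ⟨K, hK⟩ := (isCompact_Icc (a := -M) (b := M)).exists_bound_of_continuousOn
    ((hφ.continuous_deriv le_rfl).pow 2).continuousOn
  have hK' : ∀ ξ ∈ Set.Icc (-M) M, deriv φ ξ ^ 2 ≤ K := fun ξ hξ =>
    (le_abs_self _).trans (hK ξ hξ)
  have hK0 : 0 ≤ K := (sq_nonneg _).trans (hK' _ (hM' a ⟨le_rfl, hab.le⟩))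
  exact (hfr.comp hφ.continuous).exists_isBracket lam hjump
    (fun s t hs hst ht => exists_tendsto_sqSum_comp hab hp1 hp2 hφ hf hfr hg hh hV hgd hhp hjump
      hM' hK' hK0 hs hst ht)
    (fun t ht η hη => eventually_innerSum_comp_le_left hp1 hp2 hdiff hf hg hh hV hgd hhp
      hM' hK' hK0 ht hη)
    (fun s hs η hη => eventually_innerSum_comp_le_right hp1 hp2 hdiff hf hg hh hV hgd hhp
      hM' hK' hK0 hs hη)

end

/-! ### The dual class, the cross terms and the conclusion. -/

theorem IsBracket.sub_const {a b : ℝ} {lam : NestedPartitions a b} {F W : ℝ → ℝ}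
    (hF : IsRegulated a b F) (hW : IsBracket lam F W) (c : ℝ) :
    IsBracket lam (fun x => F x - c) W := by
  refine ⟨hW.1, hW.2.1, fun s t hs hst ht => ?_, fun t ht => ?_, fun s hs => ?_⟩
  · refine (hW.2.2.1 s t hs hst ht).congr fun m => ?_
    simp [IntervalPartition.sqSum]
  · rw [hW.2.2.2.1 t ht, leftJump_eq_of_tendsto ((hF.tendsto_left ht).sub_const c), leftJump]
    ring
  · rw [hW.2.2.2.2 s hs, rightJump_eq_of_tendsto ((hF.tendsto_right hs).sub_const c), rightJump]
    ring

theorem memDual_comp_sub_const {a b p C : ℝ} {φ f g h : ℝ → ℝ} (hab : a < b) (hp2 : p < 2)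
    (hφ : ContDiff ℝ 1 φ) (hf : ∀ t ∈ Set.Icc a b, f t = C + g t + h t)
    (hfr : IsRegulated a b f) (hg : IsRegulated a b g) (hh : IsRegulated a b h)
    (hgd : MemDual a b p g) (hhp : HasBoundedPVariation a b p h) (c : ℝ) :
    MemDual a b p fun x => (φ ∘ f) x - c := by
  rcases hgd with ⟨hp, -⟩ | ⟨hp, q, hq, hpq, hgq⟩
  · exact Or.inl ⟨hp, (hfr.comp hφ.continuous).sub_const c⟩
  · have hp0 : 0 < p := by linarith
    have hr0 : 0 < max p q := hp0.trans_le (le_max_left _ _)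
    -- Both `g` and `h` have bounded variation of order `max p q`. If this is `q`, duality is given;
    -- if it is `p`, then `2/p > 1`.
    refine Or.inr ⟨hp, max p q, hr0, ?_, ?_⟩
    · rcases le_total p q with h | h
      · rwa [max_eq_right h]
      · rw [max_eq_left h, ← two_mul, mul_one_div, lt_div_iff₀ hp0]
        linarith
    · have h1 := hgq.mono_exponent hab hq (le_max_right p q) hg
      have h2 := hhp.mono_exponent hab hp0 (le_max_left p q) hh
      obtain ⟨M, hM⟩ := hfr.exists_bound hab
      obtain ⟨L, hL⟩ := (isCompact_Icc (a := -M) (b := M)).exists_bound_of_continuousOn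
        (hφ.continuous_deriv le_rfl).continuousOn
      have hM' : ∀ x ∈ Set.Icc a b, f x ∈ Set.Icc (-M) M := fun x hx => abs_le.1 (hM x hx)
      have hL0 : 0 ≤ L := (norm_nonneg _).trans (hL _ (hM' a ⟨le_rfl, hab.le⟩))
      refine HasBoundedPVariation.of_abs_sub_le hr0 hL0 h1 h2 fun x hx y hy => ?_
      obtain ⟨ξ, hξ, he⟩ :=
        exists_mem_uIcc_sub_eq_deriv_mul (hφ.differentiable one_ne_zero) (f x) (f y)
      have h3 : |deriv φ ξ| ≤ L := hL ξ (Set.ordConnected_Icc.uIcc_subset (hM' x hx) (hM' y hy) hξ)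
      simp only [Function.comp_apply, sub_sub_sub_cancel_right]
      rw [he, abs_mul, sub_eq_of_eq_const_add hf hx hy]
      exact mul_le_mul h3 (abs_add_le _ _) (abs_nonneg _) hL0

/-- A composition `φ ∘ (C + g + h)` has no left jump where `g` and `h` have none. -/
theorem leftJump_comp_eq_zero {a b C x : ℝ} {φ f g h : ℝ → ℝ} (hφ : Continuous φ)
    (hf : ∀ t ∈ Set.Icc a b, f t = C + g t + h t) (hg : IsRegulated a b g)
    (hh : IsRegulated a b h) (hx : x ∈ Set.Ioc a b) (hgx : leftJump g x = 0)
    (hhx : leftJump h x = 0) : leftJump (φ ∘ f) x = 0 := by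
  have h1 := ((hg.tendsto_left hx).const_add C).add (hh.tendsto_left hx)
  rw [← sub_eq_zero.1 hgx, ← sub_eq_zero.1 hhx, ← hf x ⟨hx.1.le, hx.2⟩] at h1
  have h2 : Tendsto f (𝓝[<] x) (𝓝 (f x)) := by
    refine h1.congr' ?_
    filter_upwards [Ioo_mem_nhdsLT hx.1] with y hy
    exact (hf y ⟨hy.1.le, hy.2.le.trans hx.2⟩).symm
  rw [leftJump_eq_of_tendsto ((hφ.tendsto _).comp h2), Function.comp_apply, sub_self]

/-- A composition `φ ∘ (C + g + h)` has no right jump where `g` and `h` have none. -/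
theorem rightJump_comp_eq_zero {a b C x : ℝ} {φ f g h : ℝ → ℝ} (hφ : Continuous φ)
    (hf : ∀ t ∈ Set.Icc a b, f t = C + g t + h t) (hg : IsRegulated a b g)
    (hh : IsRegulated a b h) (hx : x ∈ Set.Ico a b) (hgx : rightJump g x = 0)
    (hhx : rightJump h x = 0) : rightJump (φ ∘ f) x = 0 := by
  have h1 := ((hg.tendsto_right hx).const_add C).add (hh.tendsto_right hx)
  rw [sub_eq_zero.1 hgx, sub_eq_zero.1 hhx, ← hf x ⟨hx.1, hx.2.le⟩] at h1
  have h2 : Tendsto f (𝓝[>] x) (𝓝 (f x)) := by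
    refine h1.congr' ?_
    filter_upwards [Ioo_mem_nhdsGT hx.2] with y hy
    exact (hf y ⟨hx.1.trans hy.1.le, hy.2.le⟩).symm
  rw [rightJump_eq_of_tendsto ((hφ.tendsto _).comp h2), Function.comp_apply, sub_self]

theorem mainTheorem2 {a b : ℝ} (hab : a < b) (lam : NestedPartitions a b)
    {p : ℝ} (hp1 : 1 ≤ p) (hp2 : p < 2) (f : ℝ → ℝ) (hf : IsDecomposable lam p f)
    (φ : ℝ → ℝ) (hφ : ContDiff ℝ 2 φ)
    (hne : (dualPairsPlus lam p f ∪ dualPairsMinus lam p f).Nonempty) :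
    IsDecomposable lam p (φ ∘ f) := by
  obtain ⟨⟨g, h⟩, hgh⟩ := hne
  have hmem : (g, h) ∈ dualPairs lam p f := hgh.elim (fun H => H.1) fun H => H.1
  obtain ⟨hg, hh, ⟨-, V, hV⟩, hgd, hhp, -, -, C, hC⟩ := hmem
  have hφ1 : ContDiff ℝ 1 φ := hφ.of_le one_le_two
  have hF : IsRegulated a b (φ ∘ f) := hf.1.comp hφ1.continuous
  have hjump : ∀ x ∈ Set.Ioo a b, x ∉ lam.points →
      leftJump (φ ∘ f) x * rightJump (φ ∘ f) x = 0 := by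
    intro x hx hxl
    -- At an inaccessible point `g` and `h` have no jump on one and the same side, so neither does
    -- `φ ∘ f`.
    rcases hgh with ⟨-, h1, h2⟩ | ⟨-, h1, h2⟩
    · rw [rightJump_comp_eq_zero hφ1.continuous hC hg hh ⟨hx.1.le, hx.2⟩
        (not_not.1 fun H => hxl (h1 ⟨hx, H⟩)) (not_not.1 fun H => hxl (h2 ⟨hx, H⟩)), mul_zero]
    · rw [leftJump_comp_eq_zero hφ1.continuous hC hg hh ⟨hx.1, hx.2.le⟩
        (not_not.1 fun H => hxl (h1 ⟨hx, H⟩)) (not_not.1 fun H => hxl (h2 ⟨hx, H⟩)), zero_mul]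
  obtain ⟨W, hW⟩ := exists_isBracket_comp hab hp1 hp2 hφ1 hC hf.1 hg hh hV hgd hhp hjump
  have hG := hF.sub_const ((φ ∘ f) a)
  have h0 : IsRegulated a b fun _ => (0 : ℝ) :=
    ⟨fun _ _ => ⟨0, tendsto_const_nhds⟩, fun _ _ => ⟨0, tendsto_const_nhds⟩⟩
  -- The whole composition, normalised at `a`, serves as first component, so nothing is left for the
  -- second.
  refine ⟨hF, (fun x => (φ ∘ f) x - (φ ∘ f) a, fun _ => 0), hG, h0,
    ⟨hG, W, hW.sub_const hF _⟩,
    memDual_comp_sub_const hab hp2 hφ1 hC hf.1 hg hh hgd hhp _,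
    HasBoundedPVariation.const (by linarith) 0, sub_self _, rfl, (φ ∘ f) a, fun t _ => ?_⟩
  ring
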